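/- Let $d\ge 1$ and $\Delta x>0$. For $\alpha\in\mathbb Z^d$ put $x_\alpha=\alpha\Delta x$ and $\delta_\alpha=\Delta x^{-d}\mathbf 1_{\{\alpha=0\}}$. For functions on $\mathbb Z^d$ let $\nabla_+^j u_\alpha=(u_{\alpha+e_j}-u_\alpha)/\Delta x$ and $\nabla_-^j u_\alpha=(u_\alpha-u_{\alpha-e_j})/\Delta x$. For functions on $\mathbb Z^d\times\mathbb Z^d$ let $(F\star G)_{\alpha,\beta}=\sum_{\eta\in\mathbb Z^d}F_{\alpha,\eta}G_{\eta,\beta}\Delta x^d$. Let $\|f\|_{L^q}=(\sum_\alpha|f_\alpha|^q\Delta x^d)^{1/q}$ for $q<\infty$ and $\|f\|_{L^\infty}=\sup_\alpha|f_\alpha|$. Let $c^j_\alpha$ ($\alpha\in\mathbb Z^d$, $1\le j\le d$) satisfy $0<c_{\min}\le c^j_\alpha\le c_{\max}$ and $|c^j_\alpha-c^j_\beta|\le L|x_\alpha-x_\beta|$ for all $\alpha,\beta,j$, and put $\overline c=\sup_{\alpha,j}c^j_\alpha$. A fundamental solution on $[0,T]$ of the semi-discrete heat equation with coefficients $c$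 is a function $\Gamma$ in $C^1([0,T];\ell^\infty(\mathbb Z^d\times\mathbb Z^d))$ with $$\frac{d}{dt}\Gamma_{\alpha,\beta}(t)=\sum_{j=1}^d c^j_\alpha\nabla^j_+\nabla^j_-\Gamma_{\alpha,\beta}(t)\quad(0<t\le T),\qquad \Gamma_{\alpha,\beta}(0)=\delta_{\alpha-\beta},$$ where the differences act on $\alpha$. For $\beta\in\mathbb Z^d$ let $$a_{\alpha,\beta}(t)=\sum_{i=0}^\infty\frac{t^i}{i!}\Bigl(\sum_{j=1}^d c^j_\beta\nabla^j_+\nabla^j_-\Bigr)^i\delta_\alpha$$ be the heat kernel of the equation with coefficients frozen at $\beta$. Put $K_{\alpha,\beta}(t)=\sum_j(c^j_\alpha-c^j_\beta)\nabla^j_+\nabla^j_-a_{\alpha-\beta,\beta}(t)$ (differences acting on $\alpha$), $K^{(1)}=K$, $K^{(m)}_{\alpha,\beta}(t)=\int_0^t\bigl(K(t-s)\star K^{(m-1)}(s)\bigr)_{\alpha,\beta}\,ds$ for $m\ge2$, and $\Phi=\sum_{m\ge1}K^{(m)}$. Then for each fixed $\beta$ the function $(t,\alpha,\gamma)\mapsto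 a_{\alpha-\gamma,\beta}(t)$ is, on every $[0,T]$, a fundamental solution of the equation with the constant coefficients $c^j_\beta$; all series and integrals above and below converge; and $$\Gamma_{\alpha,\beta}(t)=a_{\alpha-\beta,\beta}(t)+\int_0^t\sum_{\eta\in\mathbb Z^d}a_{\alpha-\eta,\eta}(t-s)\,\Phi_{\eta,\beta}(s)\,\Delta x^d\,ds$$ is, on every $[0,T]$, a fundamental solution of the semi-discrete heat equation with coefficients $c$. Moreover: (i) $\Gamma_{\alpha,\beta}(t)=\bigl(\Gamma(s)\star\Gamma(t-s)\bigr)_{\alpha,\beta}$ for all $\alpha,\beta\in\mathbb Z^d$ and $0\le s\le t$. (ii) Let $Z(\alpha)$ be the number of zero entries of $\alpha$. For every $T>0$ there is a constant $C$, depending only on $d,T,c_{\min},c_{\max},L$ (in particular not on $\Delta x$), such that for all $t\in(0,T]$ and $\alpha,\beta\in\mathbb Z^d$ $$|\Gamma_{\alpha,\beta}(t)|\le C\Bigl(\frac1{\sqrt{2\overline c}}\wedge\frac{t^{1/2}}{\Delta x}\Bigr)^{Z(\alpha-\beta)}t^{-d/2}\prod_{j=1}^d\Bigl(1+\frac{|x^j_\alpha-x^j_\beta|^2}{2\overline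 c\,t}\Bigr)^{-1}.$$ (iii) For every $T>0$ and $p\in[1,\infty]$ with dual exponent $p'$ (that is, $1/p+1/p'=1$) there is a constant $C$, depending only on $d,T,p,c_{\min},c_{\max},L$, such that for all $t\in(0,T]$ and $\alpha,\beta\in\mathbb Z^d$ $$\|\Gamma_{\cdot,\beta}(t)\|_{L^{p'}}+\|\Gamma_{\alpha,\cdot}(t)\|_{L^{p'}}\le C\,t^{-d/(2p)}.$$ -/

import Mathlib

open scoped ENNReal

namespace SemiDiscreteHeat

noncomputable section

/-- Grid indices `α ∈ ℤ^d`. -/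
abbrev Grid (d : ℕ) : Type := Fin d → ℤ

/-- The grid point `x_α = α Δx` in Euclidean space. -/
def gridPoint {d : ℕ} (dx : ℝ) (α : Grid d) : EuclideanSpace ℝ (Fin d) :=
  WithLp.toLp 2 (fun j => (α j : ℝ) * dx)

/-- The discrete Dirac mass `δ_α = Δx^{-d} 1_{α = 0}`. -/
def dirac {d : ℕ} (dx : ℝ) (α : Grid d) : ℝ :=
  if α = 0 then (dx ^ d)⁻¹ else 0

/-- The forward difference `∇_+^j`. -/
def nablaPlus {d : ℕ} (dx : ℝ) (j : Fin d) (u : Grid d → ℝ) (α : Grid d) : ℝ :=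
  (u (α + Pi.single j 1) - u α) / dx

/-- The backward difference `∇_-^j`. -/
def nablaMinus {d : ℕ} (dx : ℝ) (j : Fin d) (u : Grid d → ℝ) (α : Grid d) : ℝ :=
  (u α - u (α - Pi.single j 1)) / dx

/-- The spatial operator `u ↦ ∑_j c_α^j ∇_+^j ∇_-^j u_α`. -/
def heatOp {d : ℕ} (dx : ℝ) (c : Grid d → Fin d → ℝ) (u : Grid d → ℝ) (α : Grid d) : ℝ :=
  ∑ j : Fin d, c α j * nablaPlus dx j (nablaMinus dx j u) α

/-- The discrete convolution `(F ⋆ G)_{α,β} = ∑_η F_{α,η} G_{η,β} Δx^d`. -/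
def dconv {d : ℕ} (dx : ℝ) (F G : Grid d → Grid d → ℝ) (α β : Grid d) : ℝ :=
  ∑' η : Grid d, F α η * G η β * dx ^ d

/-- The series that defines `dconv` converges (absolutely) at `(α, β)`. -/
def DConvSummable {d : ℕ} (dx : ℝ) (F G : Grid d → Grid d → ℝ) (α β : Grid d) : Prop :=
  Summable (fun η : Grid d => F α η * G η β * dx ^ d)

/-- The norm of `L^q_{Δx}(ℝ^d)`, `q ∈ [1, ∞]`, with the value `∞` off that space. -/
def gridNorm {d : ℕ} (dx : ℝ) (q : ℝ≥0∞) (f : Grid d → ℝ) : ℝ≥0∞ :=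
  if q = ∞ then ⨆ α : Grid d, ‖f α‖ₑ
  else (∑' α : Grid d, ‖f α‖ₑ ^ q.toReal * ENNReal.ofReal (dx ^ d)) ^ (1 / q.toReal)

/-- The assumptions on the coefficients: they are bounded, bounded away from zero, and Lipschitz
continuous with respect to the Euclidean distance of the grid points. -/
structure Admissible {d : ℕ} (dx : ℝ) (c : Grid d → Fin d → ℝ) (cmin cmax L : ℝ) : Prop where
  lower : ∀ α j, cmin ≤ c α j
  upper : ∀ α j, c α j ≤ cmax
  lipschitz : ∀ α β j, |c α j - c β j| ≤ L * ‖gridPoint dx α - gridPoint dx β‖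

/-- `c̄ = sup_{α,j} c_α^j`. -/
def supCoeff {d : ℕ} (c : Grid d → Fin d → ℝ) : ℝ :=
  ⨆ p : Grid d × Fin d, c p.1 p.2

/-- `Γ` is a fundamental solution on `[0,T]` of the equation with coefficients `c`: it belongs to
`C¹([0,T]; L^∞_{Δx}(ℝ^d × ℝ^d))`, it solves the equation in its first spatial variable, and
`Γ_{α,β}(0) = δ_{α-β}`. -/
structure IsFundamentalSolution {d : ℕ} (dx : ℝ) (c : Grid d → Fin d → ℝ) (T : ℝ)
    (Γ : ℝ → Grid d → Grid d → ℝ) : Prop where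
  regular : ∃ U : ℝ → lp (fun _ : Grid d × Grid d => ℝ) ∞,
    ContDiffOn ℝ 1 U (Set.Icc 0 T) ∧
      ∀ t ∈ Set.Icc (0 : ℝ) T, ∀ α β : Grid d, U t (α, β) = Γ t α β
  equation : ∀ t ∈ Set.Ioc (0 : ℝ) T, ∀ α β : Grid d,
    HasDerivWithinAt (fun s => Γ s α β) (heatOp dx c (fun γ => Γ t γ β) α) (Set.Icc 0 T) t
  initial : ∀ α β : Grid d, Γ 0 α β = dirac dx (α - β)

/-- The `i`-th term `(t^i / i!) (∑_j c_β^j ∇_+^j ∇_-^j)^i δ_α` of the series of the heat kernel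
with the coefficients frozen at `β`. -/
def frozenTerm {d : ℕ} (dx : ℝ) (c : Grid d → Fin d → ℝ) (t : ℝ) (α β : Grid d) (i : ℕ) : ℝ :=
  t ^ i / (i.factorial : ℝ) * ((heatOp dx (fun _ => c β))^[i] (dirac dx)) α

/-- The heat kernel `a_{α,β}(t)` with the coefficients frozen at `β`. -/
def frozenKernel {d : ℕ} (dx : ℝ) (c : Grid d → Fin d → ℝ) (t : ℝ) (α β : Grid d) : ℝ :=
  ∑' i : ℕ, frozenTerm dx c t α β i

/-- The first approximation `(α, β) ↦ a_{α-β,β}(t)` of the fundamental solution. -/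
def parametrix {d : ℕ} (dx : ℝ) (c : Grid d → Fin d → ℝ) (t : ℝ) (α β : Grid d) : ℝ :=
  frozenKernel dx c t (α - β) β

/-- `K_{α,β}(t) = ∑_j (c_α^j - c_β^j) ∇_+^j ∇_-^j a_{α-β,β}(t)`, differences acting on `α`. -/
def errKernel {d : ℕ} (dx : ℝ) (c : Grid d → Fin d → ℝ) (t : ℝ) (α β : Grid d) : ℝ :=
  ∑ j : Fin d, (c α j - c β j) *
    nablaPlus dx j (nablaMinus dx j (fun γ => parametrix dx c t γ β)) α

/-- The iterated kernels; `iterKernel dx c m` is `K^{(m+1)}`. -/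
def iterKernel {d : ℕ} (dx : ℝ) (c : Grid d → Fin d → ℝ) : ℕ → ℝ → Grid d → Grid d → ℝ
  | 0 => errKernel dx c
  | m + 1 => fun t α β =>
      ∫ s in (0 : ℝ)..t, dconv dx (errKernel dx c (t - s)) (iterKernel dx c m s) α β

/-- `Φ_{α,β}(t) = ∑_{m ≥ 1} K^{(m)}_{α,β}(t)`. -/
def Phi {d : ℕ} (dx : ℝ) (c : Grid d → Fin d → ℝ) (t : ℝ) (α β : Grid d) : ℝ :=
  ∑' m : ℕ, iterKernel dx c m t α β

/-- `Γ_{α,β}(t) = a_{α-β,β}(t) + ∫_0^t ∑_η a_{α-η,η}(t-s) Φ_{η,β}(s) Δx^d ds`. -/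
def Gam {d : ℕ} (dx : ℝ) (c : Grid d → Fin d → ℝ) (t : ℝ) (α β : Grid d) : ℝ :=
  parametrix dx c t α β +
    ∫ s in (0 : ℝ)..t, dconv dx (parametrix dx c (t - s)) (Phi dx c s) α β

/-- All series and integrals in the definition of `Gam` converge. -/
structure WellDefined {d : ℕ} (dx : ℝ) (c : Grid d → Fin d → ℝ) : Prop where
  frozen : ∀ t : ℝ, 0 ≤ t → ∀ α β : Grid d, Summable (frozenTerm dx c t α β)
  iter_sum : ∀ (m : ℕ) (t s : ℝ), 0 ≤ s → s ≤ t → ∀ α β : Grid d,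
    DConvSummable dx (errKernel dx c (t - s)) (iterKernel dx c m s) α β
  iter_int : ∀ (m : ℕ) (t : ℝ), 0 ≤ t → ∀ α β : Grid d,
    IntervalIntegrable
      (fun s => dconv dx (errKernel dx c (t - s)) (iterKernel dx c m s) α β)
      MeasureTheory.volume 0 t
  phi : ∀ t : ℝ, 0 ≤ t → ∀ α β : Grid d, Summable (fun m : ℕ => iterKernel dx c m t α β)
  gam_sum : ∀ t s : ℝ, 0 ≤ s → s ≤ t → ∀ α β : Grid d,
    DConvSummable dx (parametrix dx c (t - s)) (Phi dx c s) α β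
  gam_int : ∀ t : ℝ, 0 ≤ t → ∀ α β : Grid d,
    IntervalIntegrable
      (fun s => dconv dx (parametrix dx c (t - s)) (Phi dx c s) α β)
      MeasureTheory.volume 0 t

/-- The number `Z(α)` of zero entries of `α`. -/
def numZeros {d : ℕ} (α : Grid d) : ℕ :=
  (Finset.univ.filter (fun j : Fin d => α j = 0)).card

/-- The right-hand side of the pointwise bound, without the constant. -/
def lorentzBound {d : ℕ} (dx : ℝ) (c : Grid d → Fin d → ℝ) (t : ℝ) (α β : Grid d) : ℝ :=
  (min (1 / √(2 * supCoeff c)) (√t / dx)) ^ numZeros (α - β) * t ^ (-(d : ℝ) / 2) *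
    ∏ j : Fin d, (1 + |gridPoint dx α j - gridPoint dx β j| ^ 2 / (2 * supCoeff c * t))⁻¹

end

end SemiDiscreteHeat

open SemiDiscreteHeat

/-! For fixed `dx` every object is the kernel of a bounded operator on `ℓ¹(ℤ^d)`. With the
normalization in `entry`, composition in the Banach algebra `KernelAlg d` becomes `dconv`. Left
multiplication by `heatGen` applies the variable-coefficient operator to the first index, while the
superoperator `frozenGen` applies the operator with coefficients frozen at the second index. The
parametrix is the orbit of `1` under `exp (t • frozenGen)`, and `errKernel`, `iterKernel` and `Phi`
are the kernels of the defect of this orbit, of its Volterra iterates and of the resulting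
resolvent. Levi's identity (`levi_parametrix`) then shows that `Gam` is the kernel of `exp (t •
heatGen)` (`Gam_eq_entry`). Convergence, the equation, regularity and the semigroup law are thus
properties of an operator exponential.

This gives nothing uniform in `dx`, because the norm of the generator is controlled only through a
factor of order `dx⁻²`. The quantitative half starts from the factorization of the frozen kernel
into one-dimensional continuous-time random walk kernels (`frozenKernel_eq_prod`). Their Fourier
integrals, with up to three integrations by parts, give decay of the walk kernel and of its second
difference. These are packaged as domination by a Lorentz kernel of width `ρ = √t / dx`
(`exists_walkKernel_le_lorentzKernel`).

Two facts then close Levi's iteration with uniform constants. The product kernel `heatBound`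
reproduces itself under convolution up to the factor `80 ^ d` (`summable_heatBound_mul`). The
Lipschitz factor in `errKernel` gains one power of distance, so that the two lost spatial
derivatives cost only `t^(-1/2)`, which is integrable (`exists_parametrix_errKernel_le`). An
exponential weight in time makes the iterates decay geometrically (`abs_iterKernel_le`), hence `Phi`
and then `Gam` are dominated by `heatBound`. The pointwise bound is a comparison of this product
with the stated one, and the norm bounds interpolate between the supremum and the mass of
`heatBound`. -/

namespace SemiDiscreteHeat
noncomputable section

/-! ### Volterra equations and Levi's parametrix method in Banach algebras -/

section Volterra

variable {B : Type*} [NormedRing B] [NormedAlgebra ℝ B]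

/-- The iterated kernels of the Volterra operator `F ↦ ∫ₛ K (t - s) * F s` applied to `K`. -/
def volterraIter (K : ℝ → B) : ℕ → ℝ → B
  | 0 => K
  | m + 1 => fun t => ∫ s in (0 : ℝ)..t, K (t - s) * volterraIter K m s

/-- The resolvent kernel. -/
def volterraResolvent (K : ℝ → B) (t : ℝ) : B := ∑' m : ℕ, volterraIter K m t

theorem continuous_volterraIter {K : ℝ → B} (hK : Continuous K) (m : ℕ) :
    Continuous (volterraIter K m) := by
  induction m with
  | zero => exact hK
  | succ m ih =>
    refine intervalIntegral.continuous_parametric_intervalIntegral_of_continuous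
      (f := fun t s => K (t - s) * volterraIter K m s) ?_ continuous_id
    simp only [Function.uncurry_def]
    fun_prop

theorem abs_le_and_abs_sub_le_of_mem_uIoc {s t : ℝ} (hs : s ∈ Set.uIoc 0 t) :
    |s| ≤ |t| ∧ |t - s| ≤ |t| := by
  rcases le_total 0 t with h | h
  · rw [Set.uIoc_of_le h] at hs
    rw [abs_of_nonneg h, abs_of_nonneg hs.1.le, abs_of_nonneg (by linarith [hs.2])]
    exact ⟨hs.2, by linarith [hs.1]⟩
  · rw [Set.uIoc_of_ge h] at hs
    rw [abs_of_nonpos h, abs_of_nonpos hs.2, abs_of_nonpos (by linarith [hs.1])]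
    exact ⟨by linarith [hs.1], by linarith [hs.2]⟩

/-- The factor `|t| ^ m / m!` is the volume of the time simplex of the iterated integral. Both signs
of time are treated, so that the differential equations below hold on all of `ℝ` with two-sided
derivatives, including at `0`. -/
theorem norm_volterraIter_le {K : ℝ → B} {T M : ℝ} (hM : ∀ t, |t| ≤ T → ‖K t‖ ≤ M)
    (m : ℕ) : ∀ t, |t| ≤ T → ‖volterraIter K m t‖ ≤ M ^ (m + 1) * (|t| ^ m / m.factorial) := by
  induction m with
  | zero => intro t ht; simpa [volterraIter] using hM t ht
  | succ m ih =>
    intro t ht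
    have hM0 : 0 ≤ M := (norm_nonneg _).trans (hM t ht)
    simp only [volterraIter]
    rw [intervalIntegral.norm_intervalIntegral_eq]
    have hcont : Continuous fun s : ℝ => M * (M ^ (m + 1) * (|s| ^ m / m.factorial)) := by
      fun_prop
    refine (MeasureTheory.norm_integral_le_of_norm_le
      (g := fun s : ℝ => M * (M ^ (m + 1) * (|s| ^ m / m.factorial)))
      ((hcont.intervalIntegrable 0 t).def') ?_).trans_eq ?_
    · refine (MeasureTheory.ae_restrict_iff' measurableSet_uIoc).2 (Filter.Eventually.of_forall ?_)
      intro s hs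
      obtain ⟨h1, h2⟩ := abs_le_and_abs_sub_le_of_mem_uIoc hs
      exact (norm_mul_le _ _).trans (mul_le_mul (hM _ (h2.trans ht)) (ih s (h1.trans ht))
        (norm_nonneg _) hM0)
    · have := integral_pow_abs_sub_uIoc (a := 0) (b := t) (n := m)
      simp only [sub_zero] at this
      rw [MeasureTheory.integral_const_mul, MeasureTheory.integral_const_mul,
        MeasureTheory.integral_div, this, Nat.factorial_succ]
      push_cast
      field_simp
      ring

theorem exists_norm_bound_of_continuous {E : Type*} [NormedAddCommGroup E] {K : ℝ → E} (hK : Continuous K) (T : ℝ) :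
    ∃ M, ∀ t, |t| ≤ T → ‖K t‖ ≤ M := by
  obtain ⟨M, hM⟩ := (isCompact_Icc (a := -T) (b := T)).exists_bound_of_continuousOn
    hK.continuousOn
  exact ⟨M, fun t ht => hM t (abs_le.1 ht)⟩

theorem summable_volterra_bound (M T : ℝ) :
    Summable fun m : ℕ => M ^ (m + 1) * (T ^ m / m.factorial) := by
  refine ((Real.summable_pow_div_factorial (M * T)).mul_left M).congr fun m => ?_
  rw [mul_pow, pow_succ]; ring

theorem norm_volterraIter_le' {K : ℝ → B} {T M : ℝ} (hM : ∀ t, |t| ≤ T → ‖K t‖ ≤ M)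
    (m : ℕ) {t : ℝ} (ht : |t| ≤ T) :
    ‖volterraIter K m t‖ ≤ M ^ (m + 1) * (T ^ m / m.factorial) := by
  have hM0 : 0 ≤ M := (norm_nonneg _).trans (hM t ht)
  refine (norm_volterraIter_le hM m t ht).trans ?_
  gcongr

variable [CompleteSpace B]

theorem summable_volterraIter {K : ℝ → B} (hK : Continuous K) (t : ℝ) :
    Summable fun m => volterraIter K m t := by
  obtain ⟨M, hM⟩ := exists_norm_bound_of_continuous hK |t|
  exact Summable.of_norm_bounded (summable_volterra_bound M |t|)
    fun m => norm_volterraIter_le' hM m le_rfl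

theorem continuous_volterraResolvent {K : ℝ → B} (hK : Continuous K) :
    Continuous (volterraResolvent K) := by
  rw [continuous_iff_continuousAt]
  intro t
  obtain ⟨M, hM⟩ := exists_norm_bound_of_continuous hK (|t| + 1)
  have : ContinuousOn (volterraResolvent K) (Set.Icc (-(|t| + 1)) (|t| + 1)) :=
    continuousOn_tsum (fun m => (continuous_volterraIter hK m).continuousOn)
      (summable_volterra_bound M (|t| + 1))
      fun m s hs => norm_volterraIter_le' hM m (abs_le.2 hs)
  refine this.continuousAt (Icc_mem_nhds ?_ ?_)
  · linarith [neg_abs_le t]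
  · linarith [le_abs_self t]

/-- Splitting off the first term of the series and interchanging sum and integral gives the
resolvent equation; the factorial bound supplies the dominating series. -/
theorem volterraResolvent_eq {K : ℝ → B} (hK : Continuous K) (t : ℝ) :
    volterraResolvent K t = K t + ∫ s in (0 : ℝ)..t, K (t - s) * volterraResolvent K s := by
  obtain ⟨M, hM⟩ := exists_norm_bound_of_continuous hK |t|
  have hM0 : 0 ≤ M := (norm_nonneg _).trans (hM t le_rfl)
  have h : HasSum (fun m => ∫ s in (0 : ℝ)..t, K (t - s) * volterraIter K m s)
      (∫ s in (0 : ℝ)..t, K (t - s) * volterraResolvent K s) := by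
    refine intervalIntegral.hasSum_integral_of_dominated_convergence
      (fun m _ => M * (M ^ (m + 1) * (|t| ^ m / m.factorial))) ?_ ?_ ?_ ?_ ?_
    · intro m
      have := continuous_volterraIter hK m
      exact Continuous.aestronglyMeasurable (by fun_prop)
    · refine fun m => Filter.Eventually.of_forall fun s hs => ?_
      obtain ⟨h1, h2⟩ := abs_le_and_abs_sub_le_of_mem_uIoc hs
      exact (norm_mul_le _ _).trans (mul_le_mul (hM _ h2) (norm_volterraIter_le' hM m h1)
        (norm_nonneg _) hM0)
    · exact Filter.Eventually.of_forall fun s _ => (summable_volterra_bound M |t|).mul_left M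
    · exact intervalIntegrable_const
    · exact Filter.Eventually.of_forall fun s _ =>
        (summable_volterraIter hK s).hasSum.mul_left _
  rw [volterraResolvent, (summable_volterraIter hK t).tsum_eq_zero_add, ← h.tsum_eq]
  rfl

/-- The integral is the operator `∫ F` applied to the vector `e t`, so the product rule replaces
differentiation under the integral sign. -/
theorem hasDerivAt_integral_clm_apply {Y W : Type*} [NormedAddCommGroup Y] [NormedSpace ℝ Y]
    [NormedAddCommGroup W] [NormedSpace ℝ W] [CompleteSpace W] {F : ℝ → Y →L[ℝ] W}
    (hF : Continuous F) {e : ℝ → Y} {e' : Y} {t : ℝ} (he : HasDerivAt e e' t) :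
    HasDerivAt (fun t => ∫ s in (0 : ℝ)..t, F s (e t))
      (F t (e t) + ∫ s in (0 : ℝ)..t, F s e') t := by
  have happ : ∀ t X, (∫ s in (0 : ℝ)..t, F s) X = ∫ s in (0 : ℝ)..t, F s X :=
    fun t X => ContinuousLinearMap.intervalIntegral_apply (hF.intervalIntegrable 0 t) X
  have h1 : HasDerivAt (fun t => ∫ s in (0 : ℝ)..t, F s) (F t) t :=
    intervalIntegral.integral_hasDerivAt_right (hF.intervalIntegrable _ _)
      (hF.stronglyMeasurableAtFilter _ _) hF.continuousAt
  have h2 := h1.clm_apply he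
  simpa only [happ] using h2

section Orbit

variable {V W : Type*} [NormedAddCommGroup V] [NormedSpace ℝ V] [CompleteSpace V]
  [NormedAddCommGroup W] [NormedSpace ℝ W] [CompleteSpace W]

/-- The solution `exp (t 𝔸) v` of `u' = 𝔸 u`, `u(0) = v`. -/
def expOrbit (𝔸 : V →L[ℝ] V) (v : V) (t : ℝ) : V := NormedSpace.exp (t • 𝔸) v

theorem expOrbit_zero {V : Type*} [NormedAddCommGroup V] [NormedSpace ℝ V] (𝔸 : V →L[ℝ] V) (v : V) : expOrbit 𝔸 v 0 = v := by
  simp [expOrbit, NormedSpace.exp_zero]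

theorem hasDerivAt_expOrbit (𝔸 : V →L[ℝ] V) (v : V) (t : ℝ) :
    HasDerivAt (expOrbit 𝔸 v) (𝔸 (expOrbit 𝔸 v t)) t := by
  have h := (hasDerivAt_exp_smul_const' 𝔸 t).clm_apply (hasDerivAt_const t v)
  rw [map_zero, add_zero] at h
  exact h

theorem hasSum_expOrbit (𝔸 : V →L[ℝ] V) (v : V) (t : ℝ) :
    HasSum (fun i : ℕ => (t ^ i / (i.factorial : ℝ)) • 𝔸^[i] v) (expOrbit 𝔸 v t) := by
  have h := (NormedSpace.exp_series_hasSum_exp' (𝕂 := ℝ) (t • 𝔸)).mapL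
    (ContinuousLinearMap.apply ℝ V v)
  have e : (fun i : ℕ => (t ^ i / (i.factorial : ℝ)) • 𝔸^[i] v)
      = fun i : ℕ => ContinuousLinearMap.apply ℝ V v ((i.factorial : ℝ)⁻¹ • (t • 𝔸) ^ i) := by
    funext i
    rw [smul_pow, smul_smul, map_smul, ContinuousLinearMap.apply_apply,
      ← hom_coe_pow (fun f : V →L[ℝ] V => ⇑f) rfl (fun _ _ => rfl) 𝔸 i]
    congr 1
    ring
  rw [e]
  exact h

/-- Differentiation of `t ↦ ∫₀ᵗ m (exp ((t - s) 𝔸) v) (Φ s) ds`. -/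
theorem hasDerivAt_integral_expOrbit
    (m : V →L[ℝ] V →L[ℝ] W) (𝔸 : V →L[ℝ] V) (v : V) {Φ : ℝ → V} (hΦ : Continuous Φ) (t : ℝ) :
    HasDerivAt (fun t => ∫ s in (0 : ℝ)..t, m (expOrbit 𝔸 v (t - s)) (Φ s))
      (m v (Φ t) + ∫ s in (0 : ℝ)..t, m (𝔸 (expOrbit 𝔸 v (t - s))) (Φ s)) t := by
  have hexp : Continuous fun s : ℝ => NormedSpace.exp (s • 𝔸) :=
    continuous_iff_continuousAt.2 fun s => (hasDerivAt_exp_smul_const 𝔸 s).continuousAt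
  -- Since `exp ((t - s) 𝔸) = exp (t 𝔸) exp (-s 𝔸)`, the integrand is linear in `X = exp (t 𝔸)` with
  -- coefficients depending on `s` alone.
  let F : ℝ → ((V →L[ℝ] V) →L[ℝ] W) := fun s =>
    (m.flip (Φ s)).comp (ContinuousLinearMap.apply ℝ V (NormedSpace.exp ((-s) • 𝔸) v))
  have hF : Continuous F := by
    have h1 : Continuous fun s => m.flip (Φ s) := (ContinuousLinearMap.continuous _).comp hΦ
    have h2 : Continuous fun s : ℝ =>
        ContinuousLinearMap.apply ℝ V (NormedSpace.exp ((-s) • 𝔸) v) := by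
      refine (ContinuousLinearMap.continuous _).comp ?_
      exact (hexp.comp continuous_neg).clm_apply continuous_const
    exact h1.clm_comp h2
  have hFapp : ∀ s X, F s X = m (X (NormedSpace.exp ((-s) • 𝔸) v)) (Φ s) := fun s X => rfl
  have hsplit : ∀ t s : ℝ, NormedSpace.exp ((t - s) • 𝔸)
      = NormedSpace.exp (t • 𝔸) * NormedSpace.exp ((-s) • 𝔸) := by
    intro t s
    let _ : NormedAlgebra ℚ (V →L[ℝ] V) := NormedAlgebra.restrictScalars ℚ ℝ _
    rw [sub_eq_add_neg, add_smul, NormedSpace.exp_add_of_commute]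
    exact ((Commute.refl 𝔸).smul_left _).smul_right _
  have h2 := hasDerivAt_integral_clm_apply hF (hasDerivAt_exp_smul_const' 𝔸 t)
  simp only [hFapp] at h2
  have h0 : NormedSpace.exp (t • 𝔸) (NormedSpace.exp ((-t) • 𝔸) v) = v := by
    have := hsplit t t
    rw [sub_self, zero_smul, NormedSpace.exp_zero] at this
    exact (DFunLike.congr_fun this v).symm
  rw [h0] at h2
  simp only [expOrbit, hsplit]
  exact h2

end Orbit

/-- The integrating factor `exp (-t A)` makes `exp (-t A) * G t` constant. -/
theorem eq_exp_smul_of_hasDerivAt (A : B) {G : ℝ → B} (hG : ∀ t, HasDerivAt G (A * G t) t)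
    (h0 : G 0 = 1) (t : ℝ) : G t = NormedSpace.exp (t • A) := by
  let _ : NormedAlgebra ℚ B := NormedAlgebra.restrictScalars ℚ ℝ _
  have hd : ∀ t, HasDerivAt (fun t => NormedSpace.exp (t • (-A)) * G t) 0 t := by
    intro t
    have := (hasDerivAt_exp_smul_const (-A) t).mul (hG t)
    rw [mul_neg, neg_mul, mul_assoc, neg_add_cancel] at this
    exact this
  have hc := is_const_of_deriv_eq_zero (fun t => (hd t).differentiableAt)
    (fun t => (hd t).deriv) t 0
  simp only [zero_smul, NormedSpace.exp_zero, h0, mul_one] at hc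
  have hcomm : Commute (t • A) (t • (-A)) :=
    (((Commute.refl A).neg_right).smul_left _).smul_right _
  have h1 : NormedSpace.exp (t • A) * NormedSpace.exp (t • (-A)) = 1 := by
    rw [← NormedSpace.exp_add_of_commute hcomm]; simp
  calc G t = NormedSpace.exp (t • A) * (NormedSpace.exp (t • (-A)) * G t) := by
        rw [← mul_assoc, h1, one_mul]
    _ = NormedSpace.exp (t • A) := by rw [hc, mul_one]

/-- **Levi's parametrix method** in a Banach algebra. -/
theorem levi_parametrix (A : B) {P Q K : ℝ → B} (hQ : Continuous Q) (h0 : P 0 = 1)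
    (hPd : ∀ t, HasDerivAt P (Q t) t) (hK : ∀ t, K t = A * P t - Q t)
    (hconv : ∀ Φ : ℝ → B, Continuous Φ → ∀ t,
      HasDerivAt (fun t => ∫ s in (0 : ℝ)..t, P (t - s) * Φ s)
        (Φ t + ∫ s in (0 : ℝ)..t, Q (t - s) * Φ s) t) (t : ℝ) :
    P t + ∫ s in (0 : ℝ)..t, P (t - s) * volterraResolvent K s = NormedSpace.exp (t • A) := by
  have hPc : Continuous P := continuous_iff_continuousAt.2 fun t => (hPd t).continuousAt
  have hKc : Continuous K := by rw [funext hK]; fun_prop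
  have hΦ := continuous_volterraResolvent hKc
  refine eq_exp_smul_of_hasDerivAt A
    (G := fun t => P t + ∫ s in (0 : ℝ)..t, P (t - s) * volterraResolvent K s) ?_ ?_ t
  · intro t
    have h := (hPd t).add (hconv _ hΦ t)
    refine h.congr_deriv ?_
    -- With `Q = A P - K` the derivative becomes `A G(t)` plus `Φ - K - ∫ K Φ`, where `Φ` is the
    -- resolvent, and the resolvent equation makes this remainder vanish.
    have e : ∀ s, Q (t - s) * volterraResolvent K s
        = A * (P (t - s) * volterraResolvent K s) - K (t - s) * volterraResolvent K s := by
      intro s; rw [hK]; noncomm_ring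
    simp only [e]
    have i1 : Continuous fun s => P (t - s) * volterraResolvent K s := by fun_prop
    have i2 : Continuous fun s => A * (P (t - s) * volterraResolvent K s) := by fun_prop
    have i3 : Continuous fun s => K (t - s) * volterraResolvent K s := by fun_prop
    rw [intervalIntegral.integral_sub (i2.intervalIntegrable _ _) (i3.intervalIntegrable _ _)]
    have e2 : ∫ s in (0 : ℝ)..t, A * (P (t - s) * volterraResolvent K s)
        = A * ∫ s in (0 : ℝ)..t, P (t - s) * volterraResolvent K s :=
      (ContinuousLinearMap.mul ℝ B A).intervalIntegral_comp_comm (i1.intervalIntegrable _ _)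
    rw [e2, mul_add]
    have := volterraResolvent_eq hKc t
    rw [hK t] at this
    rw [this]
    abel
  · simp [h0]

end Volterra

/-! ### Grid kernels as bounded operators on `ℓ¹(ℤ^d)` -/

section KernelAlgebra

variable {d : ℕ}

/-- Summable grid functions. -/
abbrev GridL1 (d : ℕ) : Type := lp (fun _ : Grid d => ℝ) 1

/-- The Banach algebra of bounded operators on `ℓ¹(ℤ^d)`, which are given by kernels. -/
abbrev KernelAlg (d : ℕ) : Type := GridL1 d →L[ℝ] GridL1 d

theorem GridL1.summable_norm (f : GridL1 d) : Summable fun a => ‖f a‖ := by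
  have := (memℓp_gen_iff (p := 1) (by simp)).1 (lp.memℓp f)
  simpa using this

theorem GridL1.norm_eq (f : GridL1 d) : ‖f‖ = ∑' a, ‖f a‖ := by
  rw [lp.norm_eq_tsum_rpow (by simp)]; simp

theorem memℓp_one_of_summable {f : Grid d → ℝ} (hf : Summable fun a => ‖f a‖) :
    Memℓp f 1 := by
  rw [memℓp_gen_iff (by simp)]; simpa using hf

/-- The operator `(T f)_α = w_α f_{σ α}`. -/
def weightedPerm (σ : Grid d ≃ Grid d) (w : Grid d → ℝ) (M : ℝ) (hw : ∀ a, |w a| ≤ M) :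
    KernelAlg d :=
  have hs : ∀ f : GridL1 d, Summable fun a => M * ‖f (σ a)‖ := fun f =>
    ((σ.summable_iff (f := fun a => ‖f a‖)).2 f.summable_norm).mul_left M
  have hle : ∀ (f : GridL1 d) a, ‖w a * f (σ a)‖ ≤ M * ‖f (σ a)‖ := fun f a => by
    rw [norm_mul]
    exact mul_le_mul_of_nonneg_right (hw a) (norm_nonneg _)
  have hs' : ∀ f : GridL1 d, Summable fun a => ‖w a * f (σ a)‖ := fun f =>
    Summable.of_nonneg_of_le (fun _ => norm_nonneg _) (hle f) (hs f)
  LinearMap.mkContinuous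
    { toFun := fun f => ⟨fun a => w a * f (σ a), memℓp_one_of_summable (hs' f)⟩
      map_add' := fun f g => by ext a; exact mul_add _ _ _
      map_smul' := fun r f => by ext a; simp [mul_left_comm] } M fun f => by
        rw [GridL1.norm_eq, GridL1.norm_eq, ← σ.tsum_eq (fun a => ‖f a‖), ← tsum_mul_left]
        exact (hs' f).tsum_le_tsum (hle f) (hs f)

@[simp] theorem weightedPerm_apply (σ : Grid d ≃ Grid d) (w : Grid d → ℝ) (M : ℝ)
    (hw : ∀ a, |w a| ≤ M) (f : GridL1 d) (a : Grid d) :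
    weightedPerm σ w M hw f a = w a * f (σ a) := rfl

/-- Translation by `v`. -/
def shiftOp (v : Grid d) : KernelAlg d :=
  weightedPerm (Equiv.addRight v) (fun _ => 1) 1 (by simp)

@[simp] theorem shiftOp_apply (v : Grid d) (f : GridL1 d) (a : Grid d) :
    shiftOp v f a = f (a + v) := by simp [shiftOp]

open Classical in
/-- Multiplication by a bounded function. -/
def mulOp (w : Grid d → ℝ) : KernelAlg d :=
  -- The value `0` for unbounded weights makes the definition total, so coefficient families need no
  -- bundled bound.
  if h : ∃ M, ∀ a, |w a| ≤ M then weightedPerm (Equiv.refl _) w h.choose h.choose_spec else 0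

theorem mulOp_apply {w : Grid d → ℝ} (h : ∃ M, ∀ a, |w a| ≤ M) (f : GridL1 d) (a : Grid d) :
    mulOp w f a = w a * f a := by simp [mulOp, h]

theorem mulOp_single {w : Grid d → ℝ} (h : ∃ M, ∀ a, |w a| ≤ M) (b : Grid d) :
    mulOp w (lp.single 1 b 1) = w b • lp.single 1 b (1 : ℝ) := by
  ext a
  rw [mulOp_apply h]
  rcases eq_or_ne a b with rfl | hab
  · simp
  · simp [hab]

/-- The second difference `∇_+^j ∇_-^j`. -/
def diffOp (dx : ℝ) (j : Fin d) : KernelAlg d :=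
  (dx ^ 2)⁻¹ • (shiftOp (Pi.single j 1) + shiftOp (-Pi.single j 1) - (2 : ℝ) • 1)

theorem nablaPlus_nablaMinus (dx : ℝ) (j : Fin d) (u : Grid d → ℝ) (α : Grid d) :
    nablaPlus dx j (nablaMinus dx j u) α
      = (dx ^ 2)⁻¹ * (u (α + Pi.single j 1) + u (α - Pi.single j 1) - 2 * u α) := by
  simp only [nablaPlus, nablaMinus, add_sub_cancel_right]
  rcases eq_or_ne dx 0 with rfl | h
  · simp
  · field_simp; ring

theorem diffOp_apply (dx : ℝ) (j : Fin d) (f : GridL1 d) (a : Grid d) :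
    diffOp dx j f a = nablaPlus dx j (nablaMinus dx j f) a := by
  rw [nablaPlus_nablaMinus]
  have h : diffOp dx j f a = (dx ^ 2)⁻¹ * (shiftOp (Pi.single j 1) f a
    + shiftOp (-Pi.single j 1) f a - 2 * f a) := rfl
  rw [h, shiftOp_apply, shiftOp_apply, sub_eq_add_neg a]

theorem norm_single_one (b : Grid d) : ‖lp.single (E := fun _ : Grid d => ℝ) 1 b (1 : ℝ)‖ = 1 := by
  rw [lp.norm_single (by simp)]; simp

/-- The kernel of an operator, normalized such that composition becomes `dconv`. -/
def entry (dx : ℝ) (α β : Grid d) : KernelAlg d →L[ℝ] ℝ :=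
  LinearMap.mkContinuous
    { toFun := fun F => (dx ^ d)⁻¹ * F (lp.single 1 β 1) α
      map_add' := fun F G => by simp [mul_add]
      map_smul' := fun r F => by simp [mul_left_comm] } |(dx ^ d)⁻¹| fun F => by
        simp only [LinearMap.coe_mk, AddHom.coe_mk, norm_mul, Real.norm_eq_abs]
        gcongr
        have h1 := lp.norm_apply_le_norm (p := 1) (by simp) (F (lp.single 1 β 1)) α
        have h2 := F.le_opNorm (lp.single 1 β 1)
        rw [norm_single_one, mul_one] at h2
        exact h1.trans h2

theorem entry_apply (dx : ℝ) (α β : Grid d) (F : KernelAlg d) :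
    entry dx α β F = (dx ^ d)⁻¹ * F (lp.single 1 β 1) α := rfl

theorem abs_entry_le (dx : ℝ) (α β : Grid d) (F : KernelAlg d) :
    |entry dx α β F| ≤ |(dx ^ d)⁻¹| * ‖F‖ :=
  LinearMap.mkContinuous_norm_le _ (abs_nonneg _) _ |> fun h =>
    ((entry dx α β).le_opNorm F).trans (mul_le_mul_of_nonneg_right h (norm_nonneg _))

/-- The kernel as a bounded function of both variables. -/
def entryLp (dx : ℝ) : KernelAlg d →L[ℝ] lp (fun _ : Grid d × Grid d => ℝ) ∞ :=
  LinearMap.mkContinuous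
    { toFun := fun F => ⟨fun x => entry dx x.1 x.2 F, memℓp_infty
        ⟨|(dx ^ d)⁻¹| * ‖F‖, by rintro _ ⟨x, rfl⟩; exact abs_entry_le dx x.1 x.2 F⟩⟩
      map_add' := fun F G => by ext x; exact map_add _ _ _
      map_smul' := fun r F => by ext x; simp } |(dx ^ d)⁻¹| fun F =>
        lp.norm_le_of_forall_le (by positivity) fun x => abs_entry_le dx x.1 x.2 F

@[simp] theorem entryLp_apply (dx : ℝ) (F : KernelAlg d) (α β : Grid d) :
    entryLp dx F (α, β) = entry dx α β F := rfl

theorem entry_one (dx : ℝ) (α β : Grid d) : entry dx α β 1 = dirac dx (α - β) := by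
  rw [entry_apply, dirac]
  rcases eq_or_ne α β with rfl | h
  · simp
  · simp [h, sub_eq_zero]

/-- The column `G e_β` lies in `ℓ¹`, where it is the norm limit of its finite truncations, and the
continuous functional `f ↦ (F f)_α` can be applied termwise. Of the two factors `dx^{-d}` from the
entries, the weight `dx^d` cancels one. -/
theorem hasSum_entry_mul {dx : ℝ} (hdx : 0 < dx) (F G : KernelAlg d) (α β : Grid d) :
    HasSum (fun η => entry dx α η F * entry dx η β G * dx ^ d) (entry dx α β (F * G)) := by
  set g : GridL1 d := G (lp.single 1 β 1) with hg
  have h1 : HasSum (fun η => lp.single 1 η (g η)) g := lp.hasSum_single (by simp) g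
  have h2 := h1.mapL ((lp.evalCLM ℝ (fun _ : Grid d => ℝ) 1 α).comp F)
  have h3 := h2.mul_left (dx ^ d)⁻¹
  refine (h3.congr_fun fun η => ?_)
  have e : lp.single (E := fun _ : Grid d => ℝ) 1 η (g η) = g η • lp.single 1 η (1 : ℝ) := by
    rw [← lp.single_smul]; simp
  rw [e]
  simp only [entry_apply, ContinuousLinearMap.comp_apply, map_smul, ← hg]
  simp only [smul_eq_mul]
  have : dx ^ d ≠ 0 := by positivity
  have e2 : lp.evalCLM ℝ (fun _ : Grid d => ℝ) 1 α (F (lp.single 1 η 1))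
    = F (lp.single 1 η 1) α := rfl
  rw [e2]
  field_simp

theorem entry_mulOp_mul (dx : ℝ) {w : Grid d → ℝ} (h : ∃ M, ∀ a, |w a| ≤ M) (F : KernelAlg d)
    (α β : Grid d) : entry dx α β (mulOp w * F) = w α * entry dx α β F := by
  simp only [entry_apply, mul_apply_eq_comp, mulOp_apply h]; ring

/-- Right multiplication evaluates the weight at the second index; this is how coefficients frozen
at a varying point `β` fit into a single operator. -/
theorem entry_mul_mulOp (dx : ℝ) {w : Grid d → ℝ} (h : ∃ M, ∀ a, |w a| ≤ M) (F : KernelAlg d)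
    (α β : Grid d) : entry dx α β (F * mulOp w) = w β * entry dx α β F := by
  simp only [entry_apply, mul_apply_eq_comp, mulOp_single h, map_smul]
  exact mul_left_comm _ _ _

theorem entry_diffOp_mul (dx : ℝ) (j : Fin d) (F : KernelAlg d) (α β : Grid d) :
    entry dx α β (diffOp dx j * F)
      = nablaPlus dx j (nablaMinus dx j fun γ => entry dx γ β F) α := by
  simp only [entry_apply, mul_apply_eq_comp, diffOp_apply, nablaPlus_nablaMinus]
  ring

/-- The operator `∑_j c^j ∇_+^j ∇_-^j`. -/
def heatGen (dx : ℝ) (c : Grid d → Fin d → ℝ) : KernelAlg d :=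
  ∑ j : Fin d, mulOp (fun a => c a j) * diffOp dx j

/-- The operator `F ↦ ∑_j ∇_+^j ∇_-^j F c^j` on kernels, which freezes the coefficients at the
second variable. -/
def frozenGen (dx : ℝ) (c : Grid d → Fin d → ℝ) : KernelAlg d →L[ℝ] KernelAlg d :=
  ∑ j : Fin d, ContinuousLinearMap.mulLeftRight ℝ (KernelAlg d) (diffOp dx j)
    (mulOp fun a => c a j)

theorem frozenGen_apply (dx : ℝ) (c : Grid d → Fin d → ℝ) (F : KernelAlg d) :
    frozenGen dx c F = ∑ j : Fin d, diffOp dx j * F * mulOp (fun a => c a j) := by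
  simp [frozenGen]

variable {dx : ℝ} {c : Grid d → Fin d → ℝ}

theorem entry_heatGen_mul (hc : ∃ M, ∀ a j, |c a j| ≤ M) (F : KernelAlg d) (α β : Grid d) :
    entry dx α β (heatGen dx c * F) = heatOp dx c (fun γ => entry dx γ β F) α := by
  have hc' : ∀ j, ∃ M, ∀ a, |c a j| ≤ M := fun j => hc.imp fun M h a => h a j
  simp only [heatGen, Finset.sum_mul, map_sum, heatOp, mul_assoc]
  exact Finset.sum_congr rfl fun j _ => by rw [entry_mulOp_mul dx (hc' j), entry_diffOp_mul]

theorem entry_frozenGen (hc : ∃ M, ∀ a j, |c a j| ≤ M) (F : KernelAlg d) (α β : Grid d) :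
    entry dx α β (frozenGen dx c F) = heatOp dx (fun _ => c β) (fun γ => entry dx γ β F) α := by
  have hc' : ∀ j, ∃ M, ∀ a, |c a j| ≤ M := fun j => hc.imp fun M h a => h a j
  simp only [frozenGen_apply, map_sum, heatOp]
  exact Finset.sum_congr rfl fun j _ => by rw [entry_mul_mulOp dx (hc' j), entry_diffOp_mul]

theorem heatOp_const_comp_sub (k : Fin d → ℝ) (u : Grid d → ℝ) (α β : Grid d) :
    heatOp dx (fun _ => k) (fun γ => u (γ - β)) α = heatOp dx (fun _ => k) u (α - β) := by
  simp only [heatOp, nablaPlus_nablaMinus]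
  refine Finset.sum_congr rfl fun j _ => ?_
  rw [show α + Pi.single j 1 - β = α - β + Pi.single j 1 by abel,
    show α - Pi.single j 1 - β = α - β - Pi.single j 1 by abel]

theorem entry_heatGen_const_pow (k : Fin d → ℝ) (i : ℕ) (α β : Grid d) :
    entry dx α β (heatGen dx (fun _ => k) ^ i)
      = ((heatOp dx (fun _ => k))^[i] (dirac dx)) (α - β) := by
  have hk : ∃ M, ∀ (_ : Grid d) j, |k j| ≤ M :=
    ⟨∑ j, |k j|, fun _ j => Finset.single_le_sum (f := fun j => |k j|)
      (fun _ _ => abs_nonneg _) (Finset.mem_univ j)⟩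
  induction i generalizing α with
  | zero => simp [entry_one]
  | succ i ih =>
    rw [pow_succ', entry_heatGen_mul hk, Function.iterate_succ_apply']
    simp only [ih]
    exact heatOp_const_comp_sub k _ α β

theorem entry_frozenGen_iterate (hc : ∃ M, ∀ a j, |c a j| ≤ M) (i : ℕ) (α β : Grid d) :
    entry dx α β ((frozenGen dx c)^[i] 1)
      = ((heatOp dx (fun _ => c β))^[i] (dirac dx)) (α - β) := by
  induction i generalizing α with
  | zero => simp [entry_one]
  | succ i ih =>
    rw [Function.iterate_succ_apply', entry_frozenGen hc, Function.iterate_succ_apply']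
    simp only [ih]
    exact heatOp_const_comp_sub (c β) _ α β

/-- The freezing point `β` and the column `γ` are independent here: the frozen equation has a full
fundamental solution of its own. In `hasSum_frozenTerm'` the two coincide, which gives the
parametrix. -/
theorem hasSum_frozenTerm (t : ℝ) (α γ β : Grid d) :
    HasSum (frozenTerm dx c t (α - γ) β)
      (entry dx α γ (NormedSpace.exp (t • heatGen dx (fun _ => c β)))) := by
  have h := (NormedSpace.exp_series_hasSum_exp' (𝕂 := ℝ)
    (t • heatGen dx (fun _ : Grid d => c β))).mapL (entry dx α γ)
  convert h using 1
  funext i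
  rw [smul_pow, smul_smul, map_smul, entry_heatGen_const_pow, frozenTerm, smul_eq_mul]
  ring

/-- The operator with the kernel `parametrix`. -/
def parametrixOp (dx : ℝ) (c : Grid d → Fin d → ℝ) (t : ℝ) : KernelAlg d :=
  expOrbit (V := KernelAlg d) (frozenGen dx c) 1 t

theorem hasSum_frozenTerm' (hc : ∃ M, ∀ a j, |c a j| ≤ M) (t : ℝ) (α β : Grid d) :
    HasSum (frozenTerm dx c t (α - β) β) (entry dx α β (parametrixOp dx c t)) := by
  have h := (hasSum_expOrbit (V := KernelAlg d) (frozenGen dx c) 1 t).mapL (entry dx α β)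
  have e : frozenTerm dx c t (α - β) β = fun i : ℕ =>
      entry dx α β ((t ^ i / (i.factorial : ℝ)) • (frozenGen dx c)^[i] 1) := by
    funext i
    rw [map_smul, entry_frozenGen_iterate hc, frozenTerm, smul_eq_mul]
  rw [e]
  exact h

end KernelAlgebra

/-! ### Identification with the operator exponential and its qualitative consequences -/

section FundamentalSolution

variable {d : ℕ} {dx : ℝ} {c : Grid d → Fin d → ℝ}

theorem hasDerivAt_parametrixOp (t : ℝ) :
    HasDerivAt (parametrixOp dx c) (frozenGen dx c (parametrixOp dx c t)) t :=
  hasDerivAt_expOrbit (V := KernelAlg d) (frozenGen dx c) 1 t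

theorem continuous_parametrixOp : Continuous (parametrixOp dx c) :=
  continuous_iff_continuousAt.2 fun t => (hasDerivAt_parametrixOp t).continuousAt

/-- The operator with the kernel `errKernel`. -/
def errOp (dx : ℝ) (c : Grid d → Fin d → ℝ) (t : ℝ) : KernelAlg d :=
  heatGen dx c * parametrixOp dx c t - frozenGen dx c (parametrixOp dx c t)

theorem continuous_errOp : Continuous (errOp dx c) := by
  have := continuous_parametrixOp (dx := dx) (c := c)
  exact (continuous_const.mul this).sub ((frozenGen dx c).continuous.comp this)

theorem parametrix_eq_entry (hc : ∃ M, ∀ a j, |c a j| ≤ M) (t : ℝ) :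
    parametrix dx c t = fun α β => entry dx α β (parametrixOp dx c t) := by
  funext α β
  exact (hasSum_frozenTerm' hc t α β).tsum_eq

/-- The two generators differ only in whether the coefficient is read at the first or at the second
index, so their difference produces `c α j - c β j`. -/
theorem errKernel_eq_entry (hc : ∃ M, ∀ a j, |c a j| ≤ M) (t : ℝ) :
    errKernel dx c t = fun α β => entry dx α β (errOp dx c t) := by
  funext α β
  simp only [errKernel, errOp, map_sub, entry_heatGen_mul hc, entry_frozenGen hc,
    parametrix_eq_entry hc, heatOp, sub_mul, Finset.sum_sub_distrib]

theorem dconv_entry (hdx : 0 < dx) (F G : KernelAlg d) (α β : Grid d) :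
    dconv dx (fun α β => entry dx α β F) (fun α β => entry dx α β G) α β
      = entry dx α β (F * G) :=
  (hasSum_entry_mul hdx F G α β).tsum_eq

theorem dconvSummable_entry (hdx : 0 < dx) (F G : KernelAlg d) (α β : Grid d) :
    DConvSummable dx (fun α β => entry dx α β F) (fun α β => entry dx α β G) α β :=
  (hasSum_entry_mul hdx F G α β).summable

theorem integral_entry {F : ℝ → KernelAlg d} (hF : Continuous F) (t : ℝ) (α β : Grid d) :
    ∫ s in (0 : ℝ)..t, entry dx α β (F s) = entry dx α β (∫ s in (0 : ℝ)..t, F s) :=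
  (entry dx α β).intervalIntegral_comp_comm (hF.intervalIntegrable 0 t)

theorem iterKernel_eq_entry (hdx : 0 < dx) (hc : ∃ M, ∀ a j, |c a j| ≤ M) (m : ℕ) (t : ℝ) :
    iterKernel dx c m t = fun α β => entry dx α β (volterraIter (errOp dx c) m t) := by
  induction m generalizing t with
  | zero => exact errKernel_eq_entry hc t
  | succ m ih =>
    funext α β
    have h1 := continuous_errOp (dx := dx) (c := c)
    have h2 := continuous_volterraIter h1 m
    simp only [iterKernel, volterraIter, ih, errKernel_eq_entry hc, dconv_entry hdx]
    exact integral_entry (by fun_prop) t α β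

theorem hasSum_iterKernel (hdx : 0 < dx) (hc : ∃ M, ∀ a j, |c a j| ≤ M) (t : ℝ)
    (α β : Grid d) :
    HasSum (fun m => iterKernel dx c m t α β)
      (entry dx α β (volterraResolvent (errOp dx c) t)) := by
  simp only [iterKernel_eq_entry hdx hc]
  exact (summable_volterraIter continuous_errOp t).hasSum.mapL (entry dx α β)

theorem Phi_eq_entry (hdx : 0 < dx) (hc : ∃ M, ∀ a j, |c a j| ≤ M) (t : ℝ) :
    Phi dx c t = fun α β => entry dx α β (volterraResolvent (errOp dx c) t) := by
  funext α β
  exact (hasSum_iterKernel hdx hc t α β).tsum_eq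

/-- Levi's method applied to the parametrix operator; all qualitative statements about `Gam` pass
through this identity. -/
theorem Gam_eq_entry (hdx : 0 < dx) (hc : ∃ M, ∀ a j, |c a j| ≤ M) (t : ℝ) :
    Gam dx c t = fun α β => entry dx α β (NormedSpace.exp (t • heatGen dx c)) := by
  funext α β
  have h1 := continuous_volterraResolvent (continuous_errOp (dx := dx) (c := c))
  have h2 := continuous_parametrixOp (dx := dx) (c := c)
  simp only [Gam, Phi_eq_entry hdx hc, parametrix_eq_entry hc, dconv_entry hdx]
  rw [integral_entry (by fun_prop), ← map_add]
  congr 1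
  refine levi_parametrix (heatGen dx c) (P := parametrixOp dx c) (K := errOp dx c)
    (Q := fun t => frozenGen dx c (parametrixOp dx c t)) ((frozenGen dx c).continuous.comp h2)
    (expOrbit_zero (V := KernelAlg d) _ _) hasDerivAt_parametrixOp (fun _ => rfl) ?_ t
  intro Φ hΦ t
  -- The parametrix is an orbit of a superoperator acting on the algebra, so the orbit lemma is used
  -- with the algebra itself as the space `V` and its multiplication as the bilinear map.
  have h := hasDerivAt_integral_expOrbit (V := KernelAlg d)
    (ContinuousLinearMap.mul ℝ (KernelAlg d)) (frozenGen dx c) 1 hΦ t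
  simp only [ContinuousLinearMap.mul_apply', one_mul] at h
  exact h

theorem wellDefined (hdx : 0 < dx) (hc : ∃ M, ∀ a j, |c a j| ≤ M) : WellDefined dx c where
  frozen t _ α β := by simpa using (hasSum_frozenTerm (c := c) (dx := dx) t α 0 β).summable
  iter_sum m t s _ _ α β := by
    rw [errKernel_eq_entry hc, iterKernel_eq_entry hdx hc]
    exact dconvSummable_entry hdx _ _ α β
  iter_int m t _ α β := by
    have h1 := continuous_errOp (dx := dx) (c := c)
    have h2 := continuous_volterraIter h1 m
    simp only [errKernel_eq_entry hc, iterKernel_eq_entry hdx hc, dconv_entry hdx]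
    exact Continuous.intervalIntegrable (by fun_prop) _ _
  phi t _ α β := (hasSum_iterKernel hdx hc t α β).summable
  gam_sum t s _ _ α β := by
    rw [parametrix_eq_entry hc, Phi_eq_entry hdx hc]
    exact dconvSummable_entry hdx _ _ α β
  gam_int t _ α β := by
    have h1 := continuous_volterraResolvent (continuous_errOp (dx := dx) (c := c))
    have h2 := continuous_parametrixOp (dx := dx) (c := c)
    simp only [Phi_eq_entry hdx hc, parametrix_eq_entry hc, dconv_entry hdx]
    exact Continuous.intervalIntegrable (by fun_prop) _ _

/-- The exponential is continuously differentiable in operator norm, and the bounded linear map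
`entryLp` carries this to the space of bounded kernels. -/
theorem isFundamentalSolution_of_eq_entry_exp (hc : ∃ M, ∀ a j, |c a j| ≤ M) (T : ℝ)
    {Γ : ℝ → Grid d → Grid d → ℝ}
    (hΓ : ∀ t α β, Γ t α β = entry dx α β (NormedSpace.exp (t • heatGen dx c))) :
    IsFundamentalSolution dx c T Γ where
  regular := by
    have hd : ∀ t : ℝ, HasDerivAt (fun t : ℝ => NormedSpace.exp (t • heatGen dx c))
      (heatGen dx c * NormedSpace.exp (t • heatGen dx c)) t :=
        hasDerivAt_exp_smul_const' (heatGen dx c)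
    refine ⟨fun t => entryLp dx (NormedSpace.exp (t • heatGen dx c)), ?_, ?_⟩
    · have h1 : ContDiff ℝ 1 fun t : ℝ => NormedSpace.exp (t • heatGen dx c) := by
        rw [contDiff_one_iff_deriv]
        refine ⟨fun t => (hd t).differentiableAt, ?_⟩
        rw [funext fun t => (hd t).deriv]
        exact continuous_const.mul
          (continuous_iff_continuousAt.2 fun t => (hd t).continuousAt)
      exact ((entryLp dx).contDiff.comp h1).contDiffOn
    · intro t _ α β
      rw [entryLp_apply, hΓ]
  equation t _ α β := by
    have h := ((entry dx α β).hasFDerivAt.comp_hasDerivAt t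
      (hasDerivAt_exp_smul_const' (heatGen dx c) t)).hasDerivWithinAt (s := Set.Icc 0 T)
    rw [entry_heatGen_mul hc] at h
    simp only [hΓ]
    exact h
  initial α β := by
    rw [hΓ, zero_smul, NormedSpace.exp_zero, entry_one]

theorem Gam_semigroup (hdx : 0 < dx) (hc : ∃ M, ∀ a j, |c a j| ≤ M) (t s : ℝ)
    (α β : Grid d) :
    DConvSummable dx (Gam dx c s) (Gam dx c (t - s)) α β ∧
      Gam dx c t α β = dconv dx (Gam dx c s) (Gam dx c (t - s)) α β := by
  simp only [Gam_eq_entry hdx hc]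
  refine ⟨dconvSummable_entry hdx _ _ α β, ?_⟩
  rw [dconv_entry hdx]
  let _ : NormedAlgebra ℚ (KernelAlg d) := NormedAlgebra.restrictScalars ℚ ℝ _
  rw [← NormedSpace.exp_add_of_commute
    (((Commute.refl (heatGen dx c)).smul_left _).smul_right _), ← add_smul, add_sub_cancel]

theorem frozenKernel_eq_entry (t : ℝ) (α γ β : Grid d) :
    frozenKernel dx c t (α - γ) β
      = entry dx α γ (NormedSpace.exp (t • heatGen dx (fun _ => c β))) :=
  (hasSum_frozenTerm t α γ β).tsum_eq

theorem Admissible.bounded {cmin cmax L : ℝ} (h : Admissible dx c cmin cmax L) :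
    ∃ M, ∀ a j, |c a j| ≤ M :=
  ⟨max |cmin| |cmax|, fun a j => abs_le_max_abs_abs (h.lower a j) (h.upper a j)⟩

end FundamentalSolution

/-! ### Fourier representation of the random walk kernel -/

section WalkKernel

open Real

/-- The Fourier transform `exp (-2τ(1 - cos θ))` of the transition probabilities of the
continuous-time simple random walk on `ℤ`. -/
def walkSymbol (τ θ : ℝ) : ℝ := exp (-(2 * τ * (1 - cos θ)))

/-- The transition probabilities of the continuous-time simple random walk on `ℤ`. -/
def walkKernel (n : ℤ) (τ : ℝ) : ℝ := (2 * π)⁻¹ * ∫ θ in (-π)..π, cos (n * θ) * walkSymbol τ θ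

/-- The second difference of `walkKernel` in the space variable. -/
def walkLap (n : ℤ) (τ : ℝ) : ℝ :=
  walkKernel (n + 1) τ + walkKernel (n - 1) τ - 2 * walkKernel n τ

theorem continuous_walkSymbol (τ : ℝ) : Continuous (walkSymbol τ) := by
  unfold walkSymbol; fun_prop

theorem hasDerivAt_walkSymbol (τ θ : ℝ) :
    HasDerivAt (walkSymbol τ) (-(2 * τ * sin θ) * walkSymbol τ θ) θ := by
  have h := (((hasDerivAt_cos θ).const_sub 1).const_mul (2 * τ)).neg.exp
  refine h.congr_deriv ?_
  simp only [walkSymbol, Pi.neg_apply]; ring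

theorem walkSymbol_pos (τ θ : ℝ) : 0 < walkSymbol τ θ := exp_pos _

theorem walkSymbol_le_one {τ : ℝ} (hτ : 0 ≤ τ) (θ : ℝ) : walkSymbol τ θ ≤ 1 := by
  have : 0 ≤ 2 * τ * (1 - cos θ) := mul_nonneg (by positivity) (by linarith [cos_le_one θ])
  exact exp_le_one_iff.2 (by linarith)

/-- On `[-π, π]` one has `1 - cos θ ≥ (2/π²) θ² ≥ θ²/6`, the last step because `π² ≤ 12`. -/
theorem walkSymbol_le_gaussian {τ θ : ℝ} (hτ : 0 ≤ τ) (hθ : |θ| ≤ π) :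
    walkSymbol τ θ ≤ exp (-(τ * θ ^ 2 / 3)) := by
  have h1 := cos_le_one_sub_mul_cos_sq hθ
  have h2 : π ^ 2 ≤ 12 := by nlinarith [pi_lt_d2, pi_pos]
  have h3 : (1 : ℝ) / 6 ≤ 2 / π ^ 2 := by
    rw [div_le_div_iff₀ (by norm_num) (by positivity)]; linarith
  have h4 : θ ^ 2 / 6 ≤ 1 - cos θ := by nlinarith [sq_nonneg θ]
  refine exp_le_exp.2 (neg_le_neg ?_)
  nlinarith

/-- Half of the exponential decay pays for the polynomial: the cubic Taylor term of `exp ((1 + x) /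
6)` gives the constant `1296 = 6³ · 3!`. -/
theorem one_add_cube_mul_exp_le {x : ℝ} (hx : 0 ≤ x) :
    (1 + x) ^ 3 * exp (-(x / 3)) ≤ 1296 * exp 1 * exp (-(x / 6)) := by
  have h := pow_div_factorial_le_exp ((1 + x) / 6) (by positivity) 3
  have h1 : (1 + x) ^ 3 ≤ 1296 * exp ((1 + x) / 6) := by
    have : ((3 : ℕ).factorial : ℝ) = 6 := by norm_num [Nat.factorial]
    rw [this] at h
    linarith [show ((1 + x) / 6) ^ 3 / 6 = (1 + x) ^ 3 / 1296 by ring]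
  calc (1 + x) ^ 3 * exp (-(x / 3))
      ≤ 1296 * exp ((1 + x) / 6) * exp (-(x / 3)) := by gcongr
    _ = 1296 * (exp (1 / 6) * exp (-(x / 6))) := by
        rw [mul_assoc, ← exp_add, ← exp_add]; ring_nf
    _ ≤ 1296 * (exp 1 * exp (-(x / 6))) := by gcongr; norm_num
    _ = _ := by ring

/-- The constant of `abs_integral_le_of_abs_le`. -/
def momentConst : ℝ := 1296 * exp 1 * √(6 * π)

theorem momentConst_pos : 0 < momentConst := by unfold momentConst; positivity

/-- Polynomials in the scaled variable `τ θ²` are absorbed by the Gaussian, whose integral scales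
like `τ^(-1/2)`. The constant `D` collects terms for which a plain bound on the period is better
when `τ` is small. -/
theorem abs_integral_le_of_abs_le {τ A D : ℝ} (hτ : 0 < τ) (hA : 0 ≤ A) {f : ℝ → ℝ}
    (hf : ∀ θ, |θ| ≤ π → |f θ| ≤ A * (1 + τ * θ ^ 2) ^ 3 * walkSymbol τ θ + D) :
    |∫ θ in (-π)..π, f θ| ≤ A * momentConst / √τ + D * (2 * π) := by
  have hpi : -π ≤ π := by linarith [pi_pos]
  have hg : MeasureTheory.Integrable fun θ => A * (1296 * exp 1 * exp (-(τ / 6) * θ ^ 2)) :=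
    ((integrable_exp_neg_mul_sq (by positivity)).const_mul _).const_mul _
  have h1 : ∀ θ, |θ| ≤ π → |f θ| ≤ A * (1296 * exp 1 * exp (-(τ / 6) * θ ^ 2)) + D := by
    intro θ hθ
    refine (hf θ hθ).trans (add_le_add_left ?_ _)
    rw [mul_assoc]
    refine mul_le_mul_of_nonneg_left ?_ hA
    refine (mul_le_mul_of_nonneg_left (walkSymbol_le_gaussian hτ.le hθ)
      (by positivity)).trans ?_
    refine (one_add_cube_mul_exp_le (x := τ * θ ^ 2) (by positivity)).trans_eq ?_
    congr 2; ring
  have h2 := intervalIntegral.norm_integral_le_of_norm_le (μ := MeasureTheory.volume) hpi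
    (f := f) (g := fun θ => A * (1296 * exp 1 * exp (-(τ / 6) * θ ^ 2)) + D)
    (Filter.Eventually.of_forall fun θ hθ => h1 θ (abs_le.2 ⟨hθ.1.le, hθ.2⟩))
    (Continuous.intervalIntegrable (by fun_prop) _ _)
  rw [norm_eq_abs] at h2
  refine h2.trans ?_
  rw [intervalIntegral.integral_add hg.intervalIntegrable intervalIntegrable_const,
    intervalIntegral.integral_const, intervalIntegral.integral_of_le hpi]
  have h3 : ∫ θ in Set.Ioc (-π) π, A * (1296 * exp 1 * exp (-(τ / 6) * θ ^ 2))
      ≤ ∫ θ, A * (1296 * exp 1 * exp (-(τ / 6) * θ ^ 2)) :=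
    MeasureTheory.setIntegral_le_integral hg (Filter.Eventually.of_forall fun θ => by positivity)
  have h4 : ∫ θ, A * (1296 * exp 1 * exp (-(τ / 6) * θ ^ 2))
      = A * (1296 * exp 1 * √(π / (τ / 6))) := by
    rw [MeasureTheory.integral_const_mul, MeasureTheory.integral_const_mul, integral_gaussian]
  rw [h4] at h3
  have e : √(π / (τ / 6)) = √(6 * π) / √τ := by
    rw [← sqrt_div (by positivity)]; congr 1; field_simp
  rw [e] at h3
  have e2 : A * momentConst / √τ = A * (1296 * exp 1 * (√(6 * π) / √τ)) := by
    rw [momentConst]; ring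
  rw [e2, smul_eq_mul]
  linarith

theorem int_mul_integral_cos {f f' : ℝ → ℝ} (hf : ∀ θ, HasDerivAt f (f' θ) θ)
    (hf' : Continuous f') (n : ℤ) :
    n * ∫ θ in (-π)..π, cos (n * θ) * f θ = -∫ θ in (-π)..π, sin (n * θ) * f' θ := by
  have hfc : Continuous f := continuous_iff_continuousAt.2 fun θ => (hf θ).continuousAt
  have h := intervalIntegral.integral_deriv_mul_eq_sub (a := -π) (b := π)
    (u := fun θ => sin (n * θ)) (v := f) (u' := fun θ => cos (n * θ) * (n * 1)) (v' := f')
    (fun θ _ => ((hasDerivAt_id θ).const_mul (n : ℝ)).sin) (fun θ _ => hf θ)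
    (Continuous.intervalIntegrable (by fun_prop) _ _)
    (Continuous.intervalIntegrable (by fun_prop) _ _)
  rw [intervalIntegral.integral_add (Continuous.intervalIntegrable (by fun_prop) _ _)
    (Continuous.intervalIntegrable (by fun_prop) _ _), mul_neg, sin_neg, sin_int_mul_pi] at h
  rw [← intervalIntegral.integral_const_mul]
  have e : ∀ θ, (n : ℝ) * (cos (n * θ) * f θ) = cos (n * θ) * (n * 1) * f θ := fun θ => by ring
  simp only [e]
  linarith

/-- Here the boundary terms cancel by periodicity of `f`; in `int_mul_integral_cos` they vanish
because `sin (n π) = 0`. -/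
theorem int_mul_integral_sin {f f' : ℝ → ℝ} (hf : ∀ θ, HasDerivAt f (f' θ) θ)
    (hf' : Continuous f') (hper : f π = f (-π)) (n : ℤ) :
    n * ∫ θ in (-π)..π, sin (n * θ) * f θ = ∫ θ in (-π)..π, cos (n * θ) * f' θ := by
  have hfc : Continuous f := continuous_iff_continuousAt.2 fun θ => (hf θ).continuousAt
  have h := intervalIntegral.integral_deriv_mul_eq_sub (a := -π) (b := π)
    (u := fun θ => cos (n * θ)) (v := f) (u' := fun θ => -sin (n * θ) * (n * 1)) (v' := f')
    (fun θ _ => ((hasDerivAt_id θ).const_mul (n : ℝ)).cos) (fun θ _ => hf θ)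
    (Continuous.intervalIntegrable (by fun_prop) _ _)
    (Continuous.intervalIntegrable (by fun_prop) _ _)
  rw [intervalIntegral.integral_add (Continuous.intervalIntegrable (by fun_prop) _ _)
    (Continuous.intervalIntegrable (by fun_prop) _ _), mul_neg, cos_neg, hper, sub_self] at h
  rw [← intervalIntegral.integral_const_mul]
  have e : ∀ θ, (n : ℝ) * (sin (n * θ) * f θ) = -(-sin (n * θ) * (n * 1) * f θ) :=
    fun θ => by ring
  simp only [e, intervalIntegral.integral_neg]
  linarith

/-- Three integrations by parts. -/
theorem int_cube_mul_integral_cos {f f₁ f₂ f₃ : ℝ → ℝ} (h1 : ∀ θ, HasDerivAt f (f₁ θ) θ)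
    (h2 : ∀ θ, HasDerivAt f₁ (f₂ θ) θ) (h3 : ∀ θ, HasDerivAt f₂ (f₃ θ) θ)
    (hc : Continuous f₃) (hper : f₁ π = f₁ (-π)) (n : ℤ) :
    (n : ℝ) ^ 2 * (∫ θ in (-π)..π, cos (n * θ) * f θ) = -∫ θ in (-π)..π, cos (n * θ) * f₂ θ ∧
    (n : ℝ) ^ 3 * (∫ θ in (-π)..π, cos (n * θ) * f θ) = ∫ θ in (-π)..π, sin (n * θ) * f₃ θ := by
  have c1 : Continuous f₁ := continuous_iff_continuousAt.2 fun θ => (h2 θ).continuousAt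
  have c2 : Continuous f₂ := continuous_iff_continuousAt.2 fun θ => (h3 θ).continuousAt
  have e1 := int_mul_integral_cos h1 c1 n
  have e2 := int_mul_integral_sin h2 c2 hper n
  have e3 := int_mul_integral_cos h3 hc n
  constructor
  · linear_combination (n : ℝ) * e1 - e2
  · linear_combination (n : ℝ) ^ 2 * e1 - n * e2 - e3

/-- On the Fourier side the second difference is the multiplier `2 cos θ - 2`, which is also the
`τ`-derivative of the exponent of the symbol; hence the heat equation in `hasDerivAt_walkKernel`. -/
theorem walkLap_eq (n : ℤ) (τ : ℝ) :
    walkLap n τ = (2 * π)⁻¹ *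
      ∫ θ in (-π)..π, cos (n * θ) * ((2 * cos θ - 2) * walkSymbol τ θ) := by
  have hw := continuous_walkSymbol τ
  have hi : ∀ m : ℤ, IntervalIntegrable (fun θ => cos (m * θ) * walkSymbol τ θ)
      MeasureTheory.volume (-π) π := fun m => Continuous.intervalIntegrable (by fun_prop) _ _
  have e : ∀ θ, cos (n * θ) * ((2 * cos θ - 2) * walkSymbol τ θ)
      = cos ((n + 1 : ℤ) * θ) * walkSymbol τ θ + cos ((n - 1 : ℤ) * θ) * walkSymbol τ θ
        - 2 * (cos (n * θ) * walkSymbol τ θ) := by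
    intro θ
    push_cast
    rw [add_mul (n : ℝ), sub_mul (n : ℝ), one_mul, cos_add, cos_sub]; ring
  simp only [e]
  rw [intervalIntegral.integral_sub ((hi _).add (hi _)) ((hi n).const_mul 2),
    intervalIntegral.integral_add (hi _) (hi _), intervalIntegral.integral_const_mul]
  simp only [walkLap, walkKernel]; ring

theorem hasDerivAt_walkKernel (n : ℤ) (τ : ℝ) :
    HasDerivAt (walkKernel n) (walkLap n τ) τ := by
  rw [walkLap_eq]
  refine HasDerivAt.const_mul _ ?_
  refine (intervalIntegral.hasDerivAt_integral_of_dominated_loc_of_deriv_le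
    (F := fun τ θ => cos (n * θ) * walkSymbol τ θ)
    (F' := fun τ θ => cos (n * θ) * ((2 * cos θ - 2) * walkSymbol τ θ))
    (bound := fun _ => 4 * exp (4 * (|τ| + 1)))
    (Metric.ball_mem_nhds τ one_pos) ?_ ?_ ?_ ?_ ?_ ?_).2
  · refine Filter.Eventually.of_forall fun x => ?_
    have := continuous_walkSymbol x
    exact Continuous.aestronglyMeasurable (by fun_prop)
  · have := continuous_walkSymbol τ
    exact Continuous.intervalIntegrable (by fun_prop) _ _
  · have := continuous_walkSymbol τ
    exact Continuous.aestronglyMeasurable (by fun_prop)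
  · refine Filter.Eventually.of_forall fun θ _ x hx => ?_
    have hx1 : |x| ≤ |τ| + 1 := by
      have h1 : |x - τ| < 1 := by simpa [Real.dist_eq] using hx
      have := abs_sub_abs_le_abs_sub x τ
      linarith
    have hb : |2 * cos θ - 2| ≤ 4 := by
      rw [abs_le]; constructor <;> linarith [cos_le_one θ, neg_one_le_cos θ]
    have hs : walkSymbol x θ ≤ exp (4 * (|τ| + 1)) := by
      refine exp_le_exp.2 ?_
      have h1 : |2 * cos θ - 2| * |x| ≤ 4 * (|τ| + 1) := by gcongr
      rw [← abs_mul] at h1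
      have h2 := le_abs_self ((2 * cos θ - 2) * x)
      linarith [show -(2 * x * (1 - cos θ)) = (2 * cos θ - 2) * x by ring]
    rw [norm_eq_abs, abs_mul, abs_mul, abs_of_pos (walkSymbol_pos x θ)]
    calc |cos (n * θ)| * (|2 * cos θ - 2| * walkSymbol x θ)
        ≤ 1 * (4 * exp (4 * (|τ| + 1))) := by
          have := (walkSymbol_pos x θ).le
          gcongr
          exact abs_cos_le_one _
      _ = _ := one_mul _
  · exact intervalIntegrable_const
  · refine Filter.Eventually.of_forall fun θ _ x _ => ?_
    refine HasDerivAt.const_mul _ ?_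
    have h := ((((hasDerivAt_id x).const_mul 2).mul_const (1 - cos θ)).neg).exp
    refine h.congr_deriv ?_
    simp only [walkSymbol, id, Pi.neg_apply]; ring

theorem walkKernel_zero (n : ℤ) : walkKernel n 0 = if n = 0 then 1 else 0 := by
  rw [walkKernel]
  have : ∀ θ, walkSymbol 0 θ = 1 := fun θ => by simp [walkSymbol]
  simp only [this, mul_one]
  split_ifs with h
  · subst h
    simp [intervalIntegral.integral_const]
    field_simp
    norm_num
  · have hn : (n : ℝ) ≠ 0 := by exact_mod_cast h
    rw [intervalIntegral.integral_comp_mul_left (fun x => cos x) hn, integral_cos, mul_neg,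
      sin_neg, sin_int_mul_pi]
    simp

theorem abs_walkKernel_le_one (n : ℤ) {τ : ℝ} (hτ : 0 ≤ τ) : |walkKernel n τ| ≤ 1 := by
  have h : ‖∫ θ in (-π)..π, cos (n * θ) * walkSymbol τ θ‖ ≤ 1 * |π - -π| := by
    refine intervalIntegral.norm_integral_le_of_norm_le_const fun θ _ => ?_
    rw [norm_mul, norm_eq_abs, norm_eq_abs, abs_of_pos (walkSymbol_pos τ θ)]
    exact mul_le_one₀ (abs_cos_le_one _) (walkSymbol_pos τ θ).le (walkSymbol_le_one hτ θ)
  have e : |π - -π| = 2 * π := by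
    rw [sub_neg_eq_add, ← two_mul, abs_of_pos (by positivity)]
  rw [norm_eq_abs, one_mul, e] at h
  rw [walkKernel, abs_mul, abs_of_pos (by positivity), inv_mul_le_iff₀ (by positivity), mul_one]
  exact h

theorem abs_walkLap_le_four (n : ℤ) {τ : ℝ} (hτ : 0 ≤ τ) : |walkLap n τ| ≤ 4 := by
  have h1 := abs_le.1 (abs_walkKernel_le_one (n + 1) hτ)
  have h2 := abs_le.1 (abs_walkKernel_le_one (n - 1) hτ)
  have h3 := abs_le.1 (abs_walkKernel_le_one n hτ)
  rw [walkLap, abs_le]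
  constructor <;> linarith

end WalkKernel

/-! ### Moment bounds for the walk kernel and its second difference -/

section WalkKernelBounds

open Real

theorem abs_inv_two_pi_mul_le {I a D : ℝ} (ha : 0 ≤ a) (h : |I| ≤ a + D * (2 * π)) :
    |(2 * π)⁻¹ * I| ≤ a + D := by
  have hpi : 0 < 2 * π := by positivity
  rw [abs_mul, abs_of_pos (inv_pos.2 hpi), inv_mul_le_iff₀ hpi]
  have : a ≤ a * (2 * π) := le_mul_of_one_le_right ha (by linarith [pi_gt_three])
  linarith

theorem abs_walkKernel_le (n : ℤ) {τ : ℝ} (hτ : 0 < τ) : |walkKernel n τ| ≤ momentConst / √τ := by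
  have hM := momentConst_pos
  have h := abs_integral_le_of_abs_le (A := 1) (D := 0) hτ zero_le_one
    (f := fun θ => cos (n * θ) * walkSymbol τ θ) fun θ _ => by
      rw [abs_mul, abs_of_pos (walkSymbol_pos τ θ), add_zero, one_mul]
      have := (walkSymbol_pos τ θ).le
      have h1 : (1 : ℝ) ≤ (1 + τ * θ ^ 2) ^ 3 := one_le_pow₀ (by nlinarith [sq_nonneg θ])
      exact mul_le_mul_of_nonneg_right ((abs_cos_le_one _).trans h1) this
  have := abs_inv_two_pi_mul_le (by positivity) h
  rw [walkKernel]
  simpa using this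

theorem abs_two_mul_cos_sub_two_le (θ : ℝ) : |2 * cos θ - 2| ≤ θ ^ 2 := by
  have h := one_sub_sq_div_two_le_cos (x := θ)
  rw [abs_le]; constructor <;> nlinarith [cos_le_one θ, sq_nonneg θ]

theorem abs_two_mul_cos_sub_two_le_four (θ : ℝ) : |2 * cos θ - 2| ≤ 4 := by
  rw [abs_le]; constructor <;> linarith [cos_le_one θ, neg_one_le_cos θ]

theorem abs_walkLap_le (n : ℤ) {τ : ℝ} (hτ : 0 < τ) :
    |walkLap n τ| ≤ momentConst / (τ * √τ) := by
  have hM := momentConst_pos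
  have h := abs_integral_le_of_abs_le (A := 1 / τ) (D := 0) hτ (by positivity)
    (f := fun θ => cos (n * θ) * ((2 * cos θ - 2) * walkSymbol τ θ)) fun θ _ => by
      rw [abs_mul, abs_mul, abs_of_pos (walkSymbol_pos τ θ), add_zero, ← mul_assoc]
      refine mul_le_mul_of_nonneg_right ?_ (walkSymbol_pos τ θ).le
      have hx : 0 ≤ τ * θ ^ 2 := by positivity
      calc |cos (n * θ)| * |2 * cos θ - 2| ≤ 1 * θ ^ 2 := by
            gcongr
            · exact abs_cos_le_one _
            · exact abs_two_mul_cos_sub_two_le θ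
        _ = 1 / τ * (τ * θ ^ 2) := by field_simp
        _ ≤ 1 / τ * (1 + τ * θ ^ 2) ^ 3 := by
            gcongr
            nlinarith [pow_nonneg hx 2, pow_nonneg hx 3]
  have := abs_inv_two_pi_mul_le (by positivity) h
  rw [walkLap_eq]
  refine this.trans_eq ?_
  field_simp
  ring

theorem pow_one_le {y : ℝ} (hy : 0 ≤ y) : y ≤ (1 + y ^ 2) ^ 3 := by
  nlinarith [pow_nonneg hy 2, pow_nonneg hy 4, pow_nonneg hy 6, sq_nonneg (y - 1)]

theorem pow_three_le {y : ℝ} (hy : 0 ≤ y) : y ^ 3 ≤ (1 + y ^ 2) ^ 3 := by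
  have h : y ≤ 1 + y ^ 2 := by nlinarith [sq_nonneg (y - 1)]
  gcongr

theorem pow_five_le {y : ℝ} (hy : 0 ≤ y) : y ^ 5 ≤ (1 + y ^ 2) ^ 3 := by
  nlinarith [pow_nonneg hy 2, pow_nonneg hy 4, sq_nonneg (y ^ 3 - y ^ 2)]

/-- Three integrations by parts move `n³` onto the third derivative of the symbol. The terms in `τ²`
and `τ³` scale like `τ √τ` times a polynomial in `y = √τ |θ|` and contribute `12 + 8 = 20`; the term
`2 τ sin θ` is bounded by `2 τ` outright, which keeps the estimate linear for small `τ`. -/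
theorem abs_cube_mul_walkKernel_le (n : ℤ) {τ : ℝ} (hτ : 0 < τ) :
    |(n : ℝ)| ^ 3 * |walkKernel n τ| ≤ (20 * momentConst + 2) * τ := by
  have hM := momentConst_pos
  have d0 := hasDerivAt_walkSymbol τ
  have d1 : ∀ θ, HasDerivAt (fun θ => -(2 * τ * sin θ) * walkSymbol τ θ)
      ((-(2 * τ * cos θ) + 4 * τ ^ 2 * sin θ ^ 2) * walkSymbol τ θ) θ := fun θ =>
    (((hasDerivAt_sin θ).const_mul (2 * τ)).neg.mul (d0 θ)).congr_deriv (by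
      simp only [Pi.neg_apply]; ring)
  have d2 : ∀ θ, HasDerivAt
      (fun θ => (-(2 * τ * cos θ) + 4 * τ ^ 2 * sin θ ^ 2) * walkSymbol τ θ)
      ((2 * τ * sin θ + 12 * τ ^ 2 * sin θ * cos θ - 8 * τ ^ 3 * sin θ ^ 3) * walkSymbol τ θ) θ :=
    fun θ => ((((hasDerivAt_cos θ).const_mul (2 * τ)).neg.add
      (((hasDerivAt_sin θ).pow 2).const_mul (4 * τ ^ 2))).mul (d0 θ)).congr_deriv (by
        simp only [Pi.neg_apply, Pi.add_apply, Pi.pow_apply]; push_cast; ring)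
  have hc := continuous_walkSymbol τ
  obtain ⟨-, e⟩ := int_cube_mul_integral_cos d0 d1 d2 (by fun_prop) (by simp) n
  have hr0 : 0 < √τ := sqrt_pos.2 hτ
  have hr : √τ ^ 2 = τ := sq_sqrt hτ.le
  have h := abs_integral_le_of_abs_le (A := 20 * τ * √τ) (D := 2 * τ) hτ (by positivity)
    (f := fun θ => sin (n * θ) * ((2 * τ * sin θ + 12 * τ ^ 2 * sin θ * cos θ
      - 8 * τ ^ 3 * sin θ ^ 3) * walkSymbol τ θ)) fun θ _ => by
      set r := √τ
      set w := walkSymbol τ θ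
      have hw0 : 0 < w := walkSymbol_pos τ θ
      have hw1 : w ≤ 1 := walkSymbol_le_one hτ.le θ
      set y := r * |θ|
      have hy : 0 ≤ y := by positivity
      have hs : |sin θ| ≤ |θ| := abs_sin_le_abs
      have hx : τ * θ ^ 2 = y ^ 2 := by rw [mul_pow, sq_abs, hr]
      rw [hx]
      have t1 : |2 * τ * sin θ| ≤ 2 * τ := by
        rw [abs_mul, abs_of_pos (by positivity : 0 < 2 * τ)]
        exact mul_le_of_le_one_right (by positivity) (abs_sin_le_one θ)
      have t2 : |12 * τ ^ 2 * sin θ * cos θ| ≤ 12 * τ * r * (1 + y ^ 2) ^ 3 := by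
        rw [abs_mul, abs_mul, abs_of_pos (by positivity : 0 < 12 * τ ^ 2)]
        calc 12 * τ ^ 2 * |sin θ| * |cos θ| ≤ 12 * τ ^ 2 * |θ| * 1 := by
              gcongr; exact abs_cos_le_one θ
          _ = 12 * τ * r * y := by simp only [y]; rw [← hr]; ring
          _ ≤ _ := by gcongr; exact pow_one_le hy
      have t3 : |8 * τ ^ 3 * sin θ ^ 3| ≤ 8 * τ * r * (1 + y ^ 2) ^ 3 := by
        rw [abs_mul, abs_pow, abs_of_pos (by positivity : 0 < 8 * τ ^ 3)]
        calc 8 * τ ^ 3 * |sin θ| ^ 3 ≤ 8 * τ ^ 3 * |θ| ^ 3 := by gcongr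
          _ = 8 * τ * r * y ^ 3 := by simp only [y]; rw [← hr]; ring
          _ ≤ _ := mul_le_mul_of_nonneg_left (pow_three_le hy) (by positivity)
      have t4 := (abs_sub _ _).trans (add_le_add ((abs_add_le (2 * τ * sin θ)
        (12 * τ ^ 2 * sin θ * cos θ)).trans (add_le_add t1 t2)) t3)
      rw [abs_mul, abs_mul, abs_of_pos hw0]
      calc |sin (n * θ)| * (_ * w)
          ≤ 1 * ((2 * τ + 12 * τ * r * (1 + y ^ 2) ^ 3 + 8 * τ * r * (1 + y ^ 2) ^ 3) * w) := by
            gcongr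
            exact abs_sin_le_one _
        _ = 20 * τ * r * (1 + y ^ 2) ^ 3 * w + 2 * τ * w := by ring
        _ ≤ _ := by
            have : 2 * τ * w ≤ 2 * τ := mul_le_of_le_one_right (by positivity) hw1
            linarith
  have h' := abs_inv_two_pi_mul_le (by positivity) h
  rw [← abs_pow, ← abs_mul, walkKernel, mul_left_comm, e]
  refine h'.trans_eq ?_
  field_simp

/-- The same method for the symbol multiplied by `2 cos θ - 2`, with two and three integrations by
parts. The constant `76 = 8 + 24 + 12 + 24 + 8` adds the terms of order `√τ` in the third
derivative, and the remaining `2` comes from `2 sin θ`. -/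
theorem walkLap_moments (n : ℤ) {τ : ℝ} (hτ : 0 < τ) :
    |(n : ℝ)| ^ 2 * |walkLap n τ| ≤ 24 * momentConst / √τ ∧
    |(n : ℝ)| ^ 3 * |walkLap n τ| ≤ 76 * momentConst + 2 := by
  have hM := momentConst_pos
  have d0 : ∀ θ, HasDerivAt (fun θ => (2 * cos θ - 2) * walkSymbol τ θ)
      (-(2 * sin θ) * (1 + τ * (2 * cos θ - 2)) * walkSymbol τ θ) θ := fun θ =>
    ((((hasDerivAt_cos θ).const_mul 2).sub_const 2).mul
      (hasDerivAt_walkSymbol τ θ)).congr_deriv (by ring)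
  have d1 : ∀ θ, HasDerivAt
      (fun θ => -(2 * sin θ) * (1 + τ * (2 * cos θ - 2)) * walkSymbol τ θ)
      ((-(2 * cos θ) * (1 + τ * (2 * cos θ - 2))
        + 4 * τ * sin θ ^ 2 * (2 + τ * (2 * cos θ - 2))) * walkSymbol τ θ) θ := fun θ =>
    ((((hasDerivAt_sin θ).const_mul 2).neg.mul
      (((((hasDerivAt_cos θ).const_mul 2).sub_const 2).const_mul τ).const_add 1)).mul
      (hasDerivAt_walkSymbol τ θ)).congr_deriv (by
        simp only [Pi.neg_apply, Pi.mul_apply]; ring)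
  have d2 : ∀ θ, HasDerivAt
      (fun θ => (-(2 * cos θ) * (1 + τ * (2 * cos θ - 2))
        + 4 * τ * sin θ ^ 2 * (2 + τ * (2 * cos θ - 2))) * walkSymbol τ θ)
      ((2 * sin θ + 2 * τ * sin θ * (2 * cos θ - 2) + 24 * τ * sin θ * cos θ
        + 12 * τ ^ 2 * sin θ * cos θ * (2 * cos θ - 2) - 24 * τ ^ 2 * sin θ ^ 3
        - 8 * τ ^ 3 * sin θ ^ 3 * (2 * cos θ - 2)) * walkSymbol τ θ) θ := fun θ => by
    have hm := (((hasDerivAt_cos θ).const_mul 2).sub_const 2).const_mul τ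
    exact (((((hasDerivAt_cos θ).const_mul 2).neg.mul (hm.const_add 1)).add
      ((((hasDerivAt_sin θ).pow 2).const_mul (4 * τ)).mul (hm.const_add 2))).mul
      (hasDerivAt_walkSymbol τ θ)).congr_deriv (by
        simp only [Pi.neg_apply, Pi.mul_apply, Pi.add_apply, Pi.pow_apply]; push_cast; ring)
  have hc := continuous_walkSymbol τ
  obtain ⟨e2, e3⟩ := int_cube_mul_integral_cos d0 d1 d2 (by fun_prop) (by simp) n
  have hr0 : 0 < √τ := sqrt_pos.2 hτ
  have hr : √τ ^ 2 = τ := sq_sqrt hτ.le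
  constructor
  · have h := abs_integral_le_of_abs_le (A := 24) (D := 0) hτ (by positivity)
      (f := fun θ => cos (n * θ) * ((-(2 * cos θ) * (1 + τ * (2 * cos θ - 2))
        + 4 * τ * sin θ ^ 2 * (2 + τ * (2 * cos θ - 2))) * walkSymbol τ θ)) fun θ _ => by
        set w := walkSymbol τ θ
        have hw0 : 0 < w := walkSymbol_pos τ θ
        set m := 2 * cos θ - 2 with hm
        have hmb : |m| ≤ θ ^ 2 := abs_two_mul_cos_sub_two_le θ
        have hs : |sin θ| ≤ |θ| := abs_sin_le_abs
        set x := τ * θ ^ 2 with hx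
        have hx0 : 0 ≤ x := by positivity
        have b1 : |τ * m| ≤ x := by
          rw [abs_mul, abs_of_pos hτ]
          exact mul_le_mul_of_nonneg_left hmb hτ.le
        have b2 : |1 + τ * m| ≤ 1 + x := (abs_add_le _ _).trans (by rw [abs_one]; gcongr)
        have b3 : |2 + τ * m| ≤ 2 + x := (abs_add_le _ _).trans (by
          rw [abs_of_pos (two_pos : (0 : ℝ) < 2)]; gcongr)
        have t1 : |-(2 * cos θ) * (1 + τ * m)| ≤ 2 * (1 + x) := by
          rw [abs_mul, abs_neg, abs_mul, abs_of_pos (two_pos : (0 : ℝ) < 2)]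
          have := abs_cos_le_one θ
          gcongr
          linarith
        have t2 : |4 * τ * sin θ ^ 2 * (2 + τ * m)| ≤ 4 * x * (2 + x) := by
          rw [abs_mul, abs_mul, abs_of_pos (by positivity : 0 < 4 * τ), abs_pow]
          calc 4 * τ * |sin θ| ^ 2 * |2 + τ * m| ≤ 4 * τ * |θ| ^ 2 * (2 + x) := by gcongr
            _ = 4 * x * (2 + x) := by rw [sq_abs, hx]; ring
        rw [abs_mul, abs_mul, abs_of_pos hw0, add_zero]
        have t3 := (abs_add_le _ _).trans (add_le_add t1 t2)
        calc |cos (n * θ)| * (_ * w) ≤ 1 * ((2 * (1 + x) + 4 * x * (2 + x)) * w) := by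
              gcongr
              exact abs_cos_le_one _
          _ ≤ 24 * (1 + x) ^ 3 * w := by
              rw [one_mul]
              gcongr
              nlinarith [pow_nonneg hx0 2, pow_nonneg hx0 3]
    have h' := abs_inv_two_pi_mul_le (by positivity) h
    rw [← abs_pow, ← abs_mul, walkLap_eq, mul_left_comm, e2, mul_neg, abs_neg]
    simpa using h'
  · have h := abs_integral_le_of_abs_le (A := 76 * √τ) (D := 2) hτ (by positivity)
      (f := fun θ => sin (n * θ) * ((2 * sin θ + 2 * τ * sin θ * (2 * cos θ - 2)
        + 24 * τ * sin θ * cos θ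
        + 12 * τ ^ 2 * sin θ * cos θ * (2 * cos θ - 2) - 24 * τ ^ 2 * sin θ ^ 3
        - 8 * τ ^ 3 * sin θ ^ 3 * (2 * cos θ - 2)) * walkSymbol τ θ)) fun θ _ => by
        set r := √τ
        set w := walkSymbol τ θ
        have hw0 : 0 < w := walkSymbol_pos τ θ
        have hw1 : w ≤ 1 := walkSymbol_le_one hτ.le θ
        set m := 2 * cos θ - 2 with hm
        have hmb : |m| ≤ |θ| ^ 2 := by rw [sq_abs]; exact abs_two_mul_cos_sub_two_le θ
        have hm4 : |m| ≤ 4 := abs_two_mul_cos_sub_two_le_four θ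
        have hs : |sin θ| ≤ |θ| := abs_sin_le_abs
        have hs1 : |sin θ| ≤ 1 := abs_sin_le_one θ
        have hc1 : |cos θ| ≤ 1 := abs_cos_le_one θ
        set y := r * |θ|
        have hy : 0 ≤ y := by positivity
        have hx : τ * θ ^ 2 = y ^ 2 := by rw [mul_pow, sq_abs, hr]
        rw [hx]
        set Y := (1 + y ^ 2) ^ 3
        have hY1 : y ≤ Y := pow_one_le hy
        have hY3 : y ^ 3 ≤ Y := pow_three_le hy
        have hY5 : y ^ 5 ≤ Y := pow_five_le hy
        have t1 : |2 * sin θ| ≤ 2 := by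
          rw [abs_mul, abs_of_pos (two_pos : (0 : ℝ) < 2)]; linarith
        -- Only here is the crude bound `|m| ≤ 4` used: the quadratic bound would leave a factor `1
        -- / √τ`, which is too large for small `τ`.
        have t2 : |2 * τ * sin θ * m| ≤ 8 * r * Y := by
          rw [abs_mul, abs_mul, abs_of_pos (by positivity : 0 < 2 * τ)]
          calc 2 * τ * |sin θ| * |m| ≤ 2 * τ * |θ| * 4 := by gcongr
            _ = 8 * r * y := by simp only [y]; rw [← hr]; ring
            _ ≤ _ := by gcongr
        have t3 : |24 * τ * sin θ * cos θ| ≤ 24 * r * Y := by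
          rw [abs_mul, abs_mul, abs_of_pos (by positivity : 0 < 24 * τ)]
          calc 24 * τ * |sin θ| * |cos θ| ≤ 24 * τ * |θ| * 1 := by gcongr
            _ = 24 * r * y := by simp only [y]; rw [← hr]; ring
            _ ≤ _ := by gcongr
        have t4 : |12 * τ ^ 2 * sin θ * cos θ * m| ≤ 12 * r * Y := by
          rw [abs_mul, abs_mul, abs_mul, abs_of_pos (by positivity : 0 < 12 * τ ^ 2)]
          calc 12 * τ ^ 2 * |sin θ| * |cos θ| * |m| ≤ 12 * τ ^ 2 * |θ| * 1 * |θ| ^ 2 := by gcongr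
            _ = 12 * r * y ^ 3 := by simp only [y]; rw [← hr]; ring
            _ ≤ _ := by gcongr
        have t5 : |24 * τ ^ 2 * sin θ ^ 3| ≤ 24 * r * Y := by
          rw [abs_mul, abs_pow, abs_of_pos (by positivity : 0 < 24 * τ ^ 2)]
          calc 24 * τ ^ 2 * |sin θ| ^ 3 ≤ 24 * τ ^ 2 * |θ| ^ 3 := by gcongr
            _ = 24 * r * y ^ 3 := by simp only [y]; rw [← hr]; ring
            _ ≤ _ := by gcongr
        have t6 : |8 * τ ^ 3 * sin θ ^ 3 * m| ≤ 8 * r * Y := by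
          rw [abs_mul, abs_mul, abs_pow, abs_of_pos (by positivity : 0 < 8 * τ ^ 3)]
          calc 8 * τ ^ 3 * |sin θ| ^ 3 * |m| ≤ 8 * τ ^ 3 * |θ| ^ 3 * |θ| ^ 2 := by gcongr
            _ = 8 * r * y ^ 5 := by simp only [y]; rw [← hr]; ring
            _ ≤ _ := by gcongr
        have t := (abs_sub _ _).trans (add_le_add ((abs_sub _ _).trans (add_le_add
          ((abs_add_le _ _).trans (add_le_add ((abs_add_le _ _).trans (add_le_add
          ((abs_add_le _ _).trans (add_le_add t1 t2)) t3)) t4)) t5)) t6)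
        rw [abs_mul, abs_mul, abs_of_pos hw0]
        calc |sin (n * θ)| * (_ * w)
            ≤ 1 * ((2 + 8 * r * Y + 24 * r * Y + 12 * r * Y + 24 * r * Y + 8 * r * Y) * w) := by
              gcongr
              exact abs_sin_le_one _
          _ = 76 * r * Y * w + 2 * w := by ring
          _ ≤ _ := by linarith
    have h' := abs_inv_two_pi_mul_le (by positivity) h
    rw [← abs_pow, ← abs_mul, walkLap_eq, mul_left_comm, e3]
    refine h'.trans_eq ?_
    field_simp

end WalkKernelBounds

/-! ### Uniqueness and the product formula for the frozen kernel -/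

section ProductFormula

variable {d : ℕ} {dx : ℝ}

theorem abs_heatOp_const_le (k : Fin d → ℝ) {u : Grid d → ℝ} {B : ℝ} (hu : ∀ α, |u α| ≤ B)
    (α : Grid d) : |heatOp dx (fun _ => k) u α| ≤ (∑ j, |k j| * (4 * (dx ^ 2)⁻¹)) * B := by
  rw [heatOp, Finset.sum_mul]
  refine (Finset.abs_sum_le_sum_abs _ _).trans (Finset.sum_le_sum fun j _ => ?_)
  rw [nablaPlus_nablaMinus, abs_mul, abs_mul, abs_of_nonneg (by positivity : 0 ≤ (dx ^ 2)⁻¹)]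
  have h1 := abs_le.1 (hu (α + Pi.single j 1))
  have h2 := abs_le.1 (hu (α - Pi.single j 1))
  have h3 := abs_le.1 (hu α)
  have h4 : |u (α + Pi.single j 1) + u (α - Pi.single j 1) - 2 * u α| ≤ 4 * B := by
    rw [abs_le]; constructor <;> linarith
  calc |k j| * ((dx ^ 2)⁻¹ * |u (α + Pi.single j 1) + u (α - Pi.single j 1) - 2 * u α|)
      ≤ |k j| * ((dx ^ 2)⁻¹ * (4 * B)) := by gcongr
    _ = _ := by ring

/-- Bounded solutions of the constant-coefficient equation with zero initial value vanish. -/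
theorem eq_zero_of_hasDerivAt_heatOp (k : Fin d → ℝ) {w : ℝ → Grid d → ℝ} {T B : ℝ}
    (hT : 0 ≤ T) (hB : ∀ t ∈ Set.Icc 0 T, ∀ α, |w t α| ≤ B)
    (hw : ∀ t ∈ Set.Icc 0 T, ∀ α, HasDerivAt (fun t => w t α) (heatOp dx (fun _ => k) (w t) α) t)
    (h0 : ∀ α, w 0 α = 0) (α : Grid d) : w T α = 0 := by
  set N : ℝ := ∑ j, |k j| * (4 * (dx ^ 2)⁻¹) with hN
  have hN0 : 0 ≤ N := Finset.sum_nonneg fun j _ => by positivity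
  have hB0 : 0 ≤ B := (abs_nonneg _).trans (hB T ⟨hT, le_rfl⟩ 0)
  -- Iterated Gronwall: each integration of the equation, whose operator has sup-norm at most `N`,
  -- improves the a priori bound by one Taylor order, and the bounds tend to `0`.
  have key : ∀ i : ℕ, ∀ t ∈ Set.Icc 0 T, ∀ α, |w t α| ≤ B * ((N * t) ^ i / i.factorial) := by
    intro i
    induction i with
    | zero => simpa using hB
    | succ i ih =>
      intro t ht α
      have hd : ∀ x : ℝ, HasDerivAt (fun x : ℝ => B * ((N * x) ^ (i + 1) / (i + 1).factorial))
          (N * (B * ((N * x) ^ i / i.factorial))) x := fun x => by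
        refine (((((hasDerivAt_id x).const_mul N).pow (i + 1)).div_const
          ((i + 1).factorial : ℝ)).const_mul B).congr_deriv ?_
        rw [Nat.factorial_succ]
        push_cast
        simp only [id]
        field_simp
      refine image_norm_le_of_norm_deriv_right_le_deriv_boundary' (a := 0) (b := T)
        (f := fun t => w t α) (f' := fun t => heatOp dx (fun _ => k) (w t) α)
        (fun x hx => (hw x hx α).continuousAt.continuousWithinAt)
        (fun x hx => (hw x ⟨hx.1, hx.2.le⟩ α).hasDerivWithinAt)
        (B := fun x => B * ((N * x) ^ (i + 1) / (i + 1).factorial))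
        (B' := fun x => N * (B * ((N * x) ^ i / i.factorial))) ?_
        (fun x _ => (hd x).continuousAt.continuousWithinAt)
        (fun x _ => (hd x).hasDerivWithinAt) ?_ ht
      · simp [h0]
      · intro x hx
        exact abs_heatOp_const_le k (ih x ⟨hx.1, hx.2.le⟩) α
  have hlim := (FloorSemiring.tendsto_pow_div_factorial_atTop (N * T)).const_mul B
  rw [mul_zero] at hlim
  have := ge_of_tendsto' hlim fun i => key i T ⟨hT, le_rfl⟩ α
  exact abs_nonpos_iff.1 this

theorem prod_update_add (g : Fin d → ℤ → ℝ) (α : Grid d) (j : Fin d) (z : ℤ) :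
    ∏ i, g i ((α + Pi.single j z : Grid d) i)
      = g j (α j + z) * ∏ i ∈ Finset.univ.erase j, g i (α i) := by
  rw [← Finset.mul_prod_erase _ _ (Finset.mem_univ j)]
  congr 1
  · simp
  · refine Finset.prod_congr rfl fun i hi => ?_
    simp [Finset.ne_of_mem_erase hi]

theorem nablaPlus_nablaMinus_prod (g : Fin d → ℤ → ℝ) (α : Grid d) (j : Fin d) :
    nablaPlus dx j (nablaMinus dx j fun γ => ∏ i, g i (γ i)) α
      = (dx ^ 2)⁻¹ * ((g j (α j + 1) + g j (α j - 1) - 2 * g j (α j))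
          * ∏ i ∈ Finset.univ.erase j, g i (α i)) := by
  rw [nablaPlus_nablaMinus]
  have h1 := prod_update_add g α j 1
  have h2 := prod_update_add g α j (-1)
  have h3 := prod_update_add g α j 0
  rw [Pi.single_zero, add_zero, add_zero] at h3
  rw [Pi.single_neg, ← sub_eq_add_neg, ← sub_eq_add_neg] at h2
  rw [h1, h2, h3]
  ring

variable {c : Grid d → Fin d → ℝ}

/-- Both sides are bounded on `[0, t]`, solve the same constant-coefficient equation and start from
the discrete Dirac mass, so uniqueness of bounded solutions applies. Each coordinate runs on the
walk clock `c t / dx²`. -/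
theorem frozenKernel_eq_prod (hdx : 0 < dx) (hc : ∀ α j, 0 ≤ c α j) {t : ℝ} (ht : 0 ≤ t)
    (α β : Grid d) :
    frozenKernel dx c t α β = ∏ j, dx⁻¹ * walkKernel (α j) (c β j * t / dx ^ 2) := by
  have hk : ∃ M, ∀ (_ : Grid d) j, |c β j| ≤ M :=
    ⟨∑ j, |c β j|, fun _ j => Finset.single_le_sum (f := fun j => |c β j|)
      (fun _ _ => abs_nonneg _) (Finset.mem_univ j)⟩
  have hu := fun t α => frozenKernel_eq_entry (dx := dx) (c := c) t α 0 β
  simp only [sub_zero] at hu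
  set u : ℝ → Grid d → ℝ := fun t α => frozenKernel dx c t α β with hu_def
  set v : ℝ → Grid d → ℝ := fun t α => ∏ j, dx⁻¹ * walkKernel (α j) (c β j * t / dx ^ 2) with hv
  have hud : ∀ t α, HasDerivAt (fun t => u t α) (heatOp dx (fun _ => c β) (u t) α) t := by
    intro t α
    have h := ((entry dx α 0).hasFDerivAt.comp_hasDerivAt t
      (hasDerivAt_exp_smul_const' (heatGen dx fun _ => c β) t))
    rw [entry_heatGen_mul hk] at h
    simp only [hu_def, hu]
    exact h
  have hvd : ∀ t α, HasDerivAt (fun t => v t α) (heatOp dx (fun _ => c β) (v t) α) t := by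
    intro t α
    have hg : ∀ j ∈ Finset.univ, HasDerivAt
        (fun t => dx⁻¹ * walkKernel (α j) (c β j * t / dx ^ 2))
        (dx⁻¹ * (walkLap (α j) (c β j * t / dx ^ 2) * (c β j * 1 / dx ^ 2))) t := fun j _ =>
      (HasDerivAt.comp t (h₂ := walkKernel (α j)) (h := fun t => c β j * t / dx ^ 2)
        (hasDerivAt_walkKernel (α j) (c β j * t / dx ^ 2))
        (((hasDerivAt_id t).const_mul (c β j)).div_const (dx ^ 2))).const_mul dx⁻¹
    refine (HasDerivAt.fun_finsetProd hg).congr_deriv ?_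
    refine Finset.sum_congr rfl fun j _ => ?_
    simp only [hv]
    rw [nablaPlus_nablaMinus_prod (fun i n => dx⁻¹ * walkKernel n (c β i * t / dx ^ 2)) α j,
      smul_eq_mul, walkLap]
    ring
  have hw := eq_zero_of_hasDerivAt_heatOp (dx := dx) (c β) (w := fun t α => u t α - v t α) (T := t)
    (B := (SupSet.sSup ((fun t => |(dx ^ d)⁻¹| * ‖NormedSpace.exp (t • heatGen dx fun _ => c β)‖)
      '' Set.Icc 0 t)) + dx⁻¹ ^ d) ht ?_ ?_ ?_ α
  · exact sub_eq_zero.1 hw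
  · intro s hs α
    refine (abs_sub _ _).trans (add_le_add ?_ ?_)
    · simp only [hu_def, hu]
      refine (abs_entry_le dx α 0 _).trans ?_
      refine le_csSup (IsCompact.bddAbove_image isCompact_Icc ?_) ⟨s, hs, rfl⟩
      have : Continuous fun t : ℝ => NormedSpace.exp (t • heatGen dx fun _ => c β) :=
        continuous_iff_continuousAt.2 fun t =>
          (hasDerivAt_exp_smul_const' (heatGen dx fun _ => c β) t).continuousAt
      exact (continuous_const.mul this.norm).continuousOn
    · simp only [hv, Finset.abs_prod]
      refine (Finset.prod_le_prod (g := fun _ => dx⁻¹) (fun _ _ => abs_nonneg _)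
        fun j _ => ?_).trans_eq (by simp)
      rw [abs_mul, abs_of_pos (inv_pos.2 hdx)]
      refine mul_le_of_le_one_right (inv_pos.2 hdx).le (abs_walkKernel_le_one _ ?_)
      have := hc β j
      have := hs.1
      positivity
  · intro s _ α
    refine ((hud s α).sub (hvd s α)).congr_deriv ?_
    simp only [heatOp, nablaPlus_nablaMinus, ← Finset.sum_sub_distrib]
    exact Finset.sum_congr rfl fun j _ => by ring
  · intro α
    have h1 : u 0 α = dirac dx α := by
      simp only [hu_def, hu]
      rw [zero_smul, NormedSpace.exp_zero, entry_one, sub_zero]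
    have h2 : v 0 α = dirac dx α := by
      simp only [hv, mul_zero, zero_div, walkKernel_zero, dirac]
      split_ifs with h
      · subst h; simp
      · obtain ⟨j, hj⟩ := Function.ne_iff.1 h
        exact Finset.prod_eq_zero (Finset.mem_univ j) (by
          rw [if_neg (by simpa using hj), mul_zero])
    rw [h1, h2, sub_self]

theorem nablaPlus_nablaMinus_parametrix (hdx : 0 < dx) (hc : ∀ α j, 0 ≤ c α j) {t : ℝ}
    (ht : 0 ≤ t) (α β : Grid d) (j : Fin d) :
    nablaPlus dx j (nablaMinus dx j fun γ => parametrix dx c t γ β) α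
      = (dx ^ 2)⁻¹ * (dx⁻¹ * walkLap (α j - β j) (c β j * t / dx ^ 2)
        * ∏ i ∈ Finset.univ.erase j, dx⁻¹ * walkKernel (α i - β i) (c β i * t / dx ^ 2)) := by
  have e : (fun γ => parametrix dx c t γ β) = fun γ : Grid d =>
      ∏ i, (fun n : ℤ => dx⁻¹ * walkKernel (n - β i) (c β i * t / dx ^ 2)) (γ i) := by
    funext γ
    rw [parametrix, frozenKernel_eq_prod hdx hc ht]
    rfl
  rw [e, nablaPlus_nablaMinus_prod
    (fun i n => dx⁻¹ * walkKernel (n - β i) (c β i * t / dx ^ 2)) α j, walkLap]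
  simp only [show α j + 1 - β j = α j - β j + 1 by ring,
    show α j - 1 - β j = α j - β j - 1 by ring]
  ring

end ProductFormula

/-! ### One-dimensional discrete Lorentz kernels -/

section LorentzKernel

/-- A discrete Lorentz kernel of width `ρ`. -/
def lorentzKernel (ρ : ℝ) (n : ℤ) : ℝ :=
  if n = 0 then min 1 (1 / ρ) else ρ / (ρ ^ 2 + (n : ℝ) ^ 2)

variable {ρ : ℝ}

theorem lorentzKernel_pos (hρ : 0 < ρ) (n : ℤ) : 0 < lorentzKernel ρ n := by
  unfold lorentzKernel
  split_ifs
  · exact lt_min one_pos (by positivity)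
  · positivity

theorem lorentzKernel_neg (n : ℤ) : lorentzKernel ρ (-n) = lorentzKernel ρ n := by
  simp [lorentzKernel]

theorem one_le_int_sq {n : ℤ} (hn : n ≠ 0) : (1 : ℝ) ≤ (n : ℝ) ^ 2 := by
  have : (1 : ℤ) ≤ n ^ 2 := Order.one_le_iff_pos.2 (by positivity)
  exact_mod_cast this

theorem lorentzKernel_le_min (hρ : 0 < ρ) (n : ℤ) : lorentzKernel ρ n ≤ min 1 (1 / ρ) := by
  unfold lorentzKernel
  split_ifs with h
  · exact le_rfl
  · have h1 := one_le_int_sq h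
    refine le_min ?_ ?_
    · rw [div_le_one (by positivity)]; nlinarith [sq_nonneg (ρ - 1)]
    · rw [div_le_div_iff₀ (by positivity) hρ]; nlinarith

/-- Telescoping: each summand is at most `2ρ/(ρ+N) - 2ρ/(ρ+N+1)`, because `(ρ+N)(ρ+N+1) ≤ (ρ+N+1)² ≤
2(ρ² + (N+1)²)`. -/
theorem sum_lorentz_succ_le (hρ : 0 < ρ) (N : ℕ) :
    ∑ m ∈ Finset.range N, ρ / (ρ ^ 2 + ((m : ℝ) + 1) ^ 2) ≤ 2 - 2 * ρ / (ρ + N) := by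
  induction N with
  | zero => rw [Finset.sum_range_zero]; push_cast; rw [add_zero, mul_div_assoc, div_self hρ.ne']
            norm_num
  | succ N ih =>
    rw [Finset.sum_range_succ]
    have h : ρ / (ρ ^ 2 + ((N : ℝ) + 1) ^ 2) ≤ 2 * ρ / (ρ + N) - 2 * ρ / (ρ + (N + 1 : ℕ)) := by
      push_cast
      have e : 2 * ρ / (ρ + N) - 2 * ρ / (ρ + (N + 1))
          = 2 * ρ / ((ρ + N) * (ρ + (N + 1))) := by field_simp; ring
      rw [e, div_le_div_iff₀ (by positivity) (by positivity)]
      have : (ρ + N) * (ρ + (N + 1)) ≤ 2 * (ρ ^ 2 + ((N : ℝ) + 1) ^ 2) := by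
        nlinarith [sq_nonneg (ρ - (N + 1))]
      nlinarith
    linarith

theorem summable_lorentzKernel_nat (hρ : 0 < ρ) :
    Summable (fun m : ℕ => ρ / (ρ ^ 2 + ((m : ℝ) + 1) ^ 2)) ∧
      ∑' m : ℕ, ρ / (ρ ^ 2 + ((m : ℝ) + 1) ^ 2) ≤ 2 := by
  have h : ∀ N, ∑ m ∈ Finset.range N, ρ / (ρ ^ 2 + ((m : ℝ) + 1) ^ 2) ≤ 2 := fun N =>
    (sum_lorentz_succ_le hρ N).trans (sub_le_self _ (by positivity))
  exact ⟨summable_of_sum_range_le (fun m => by positivity) h,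
    Real.tsum_le_of_sum_range_le (fun m => by positivity) h⟩

theorem summable_lorentzKernel (hρ : 0 < ρ) :
    Summable (lorentzKernel ρ) ∧ ∑' n, lorentzKernel ρ n ≤ 5 := by
  obtain ⟨hs, hle⟩ := summable_lorentzKernel_nat hρ
  have e1 : ∀ m : ℕ, lorentzKernel ρ ((m + 1 : ℕ) : ℤ) = ρ / (ρ ^ 2 + ((m : ℝ) + 1) ^ 2) := by
    intro m
    rw [lorentzKernel, if_neg (by omega)]; push_cast; rfl
  have e2 : ∀ m : ℕ, lorentzKernel ρ (-((m : ℤ) + 1)) = ρ / (ρ ^ 2 + ((m : ℝ) + 1) ^ 2) := by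
    intro m
    rw [lorentzKernel_neg, ← e1]; push_cast; rfl
  have s1 : Summable fun m : ℕ => lorentzKernel ρ (m : ℤ) :=
    (summable_nat_add_iff 1).1 (hs.congr fun m => (e1 m).symm)
  have s2 : Summable fun m : ℕ => lorentzKernel ρ (-((m : ℤ) + 1)) :=
    hs.congr fun m => (e2 m).symm
  refine ⟨s1.of_nat_of_neg_add_one s2, ?_⟩
  rw [tsum_of_nat_of_neg_add_one s1 s2, s1.tsum_eq_zero_add, tsum_congr e1, tsum_congr e2]
  have : lorentzKernel ρ ((0 : ℕ) : ℤ) ≤ 1 :=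
    (lorentzKernel_le_min hρ _).trans (min_le_left _ _)
  exact (add_le_add (add_le_add this hle) hle).trans (by norm_num)

/-- Near regime: at such `n` the kernel of width `r` is comparable to its maximal size `min 1
(1/r)`, and the comparable width `ρ'` cannot exceed this by more than a constant at any `m`. -/
theorem lorentzKernel_le_of_sq_le {ρ' r : ℝ} (hρ' : 0 < ρ') (hr : 0 < r) (h : r ^ 2 ≤ 2 * ρ' ^ 2)
    {n : ℤ} (hn : n = 0 ∨ (n : ℝ) ^ 2 ≤ r ^ 2) (m : ℤ) :
    lorentzKernel ρ' m ≤ 4 * lorentzKernel r n := by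
  have hrr : r ≤ 2 * ρ' := by nlinarith
  have h1 : 1 / ρ' ≤ 2 / r := by rw [div_le_div_iff₀ hρ' hr]; linarith
  refine (lorentzKernel_le_min hρ' m).trans ?_
  unfold lorentzKernel
  split_ifs with h0
  · rcases min_choice 1 (1 / r) with e | e
    · rw [e]; linarith [min_le_left 1 (1 / ρ')]
    · rw [e]
      have : 4 * (1 / r) = 2 / r + 2 / r := by ring
      have h2 : 0 < 2 / r := by positivity
      linarith [min_le_right 1 (1 / ρ')]
  · have hn' := hn.resolve_left h0
    have h2 : 2 / r ≤ 4 * (r / (r ^ 2 + (n : ℝ) ^ 2)) := by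
      rw [← mul_div_assoc, div_le_div_iff₀ hr (by positivity)]
      nlinarith
    linarith [min_le_right 1 (1 / ρ')]

/-- Far regime: the tails behave like width over squared distance, and `|m|` is at least half of
`|n|`. -/
theorem lorentzKernel_le_of_le_sq {ρ' r : ℝ} (hρ' : 0 < ρ') (hr : 0 < r) (h : ρ' ≤ r) {n m : ℤ}
    (hn0 : n ≠ 0) (hn : r ^ 2 ≤ (n : ℝ) ^ 2) (hm : (n : ℝ) ^ 2 ≤ 4 * (m : ℝ) ^ 2) :
    lorentzKernel ρ' m ≤ 8 * lorentzKernel r n := by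
  have h1 := one_le_int_sq hn0
  have hm0 : m ≠ 0 := by rintro rfl; exact hn0 (by simpa using hm)
  rw [lorentzKernel, lorentzKernel, if_neg hm0, if_neg hn0, ← mul_div_assoc,
    div_le_div_iff₀ (by positivity) (by positivity)]
  have h2 : r ^ 2 + (n : ℝ) ^ 2 ≤ 8 * (ρ' ^ 2 + (m : ℝ) ^ 2) := by nlinarith [sq_nonneg ρ']
  calc ρ' * (r ^ 2 + (n : ℝ) ^ 2) ≤ r * (8 * (ρ' ^ 2 + (m : ℝ) ^ 2)) := by gcongr
    _ = _ := by ring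

/-- One of the two factors is always at most `8 * lorentzKernel r n`: in the near regime the one of
larger width, in the far regime the one whose argument is at least `|n| / 2` in size. The sum on the
right keeps the other factor, so summation over `m` uses only the total masses. The relation between
the widths is additivity of times, as `ρ² = t / dx²`. -/
theorem lorentzKernel_mul_le {ρ₁ ρ₂ r : ℝ} (h1 : 0 < ρ₁) (h2 : 0 < ρ₂) (hr : 0 < r)
    (hrr : r ^ 2 = ρ₁ ^ 2 + ρ₂ ^ 2) (n m : ℤ) :
    lorentzKernel ρ₁ (n - m) * lorentzKernel ρ₂ m
      ≤ 8 * lorentzKernel r n * (lorentzKernel ρ₁ (n - m) + lorentzKernel ρ₂ m) := by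
  have p1 := lorentzKernel_pos h1 (n - m)
  have p2 := lorentzKernel_pos h2 m
  have p3 := lorentzKernel_pos hr n
  have key : lorentzKernel ρ₁ (n - m) ≤ 8 * lorentzKernel r n ∨
      lorentzKernel ρ₂ m ≤ 8 * lorentzKernel r n := by
    by_cases hn : n = 0 ∨ (n : ℝ) ^ 2 ≤ r ^ 2
    · rcases le_total ρ₁ ρ₂ with h | h
      · right
        have := lorentzKernel_le_of_sq_le h2 hr (by nlinarith) hn m
        linarith
      · left
        have := lorentzKernel_le_of_sq_le h1 hr (by nlinarith) hn (n - m)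
        linarith
    · rw [not_or, not_le] at hn
      have hr1 : ρ₁ ≤ r := by nlinarith
      have hr2 : ρ₂ ≤ r := by nlinarith
      by_cases hm : (n : ℝ) ^ 2 ≤ 4 * (m : ℝ) ^ 2
      · exact Or.inr (lorentzKernel_le_of_le_sq h2 hr hr2 hn.1 hn.2.le hm)
      · refine Or.inl (lorentzKernel_le_of_le_sq h1 hr hr1 hn.1 hn.2.le ?_)
        push_cast
        nlinarith [sq_nonneg ((n : ℝ) - 2 * m)]
  rcases key with h | h
  · calc _ ≤ 8 * lorentzKernel r n * lorentzKernel ρ₂ m := by gcongr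
      _ ≤ _ := by gcongr; linarith
  · calc _ ≤ lorentzKernel ρ₁ (n - m) * (8 * lorentzKernel r n) := by gcongr
      _ = 8 * lorentzKernel r n * lorentzKernel ρ₁ (n - m) := by ring
      _ ≤ _ := by gcongr; linarith

end LorentzKernel

/-! ### The product kernel `heatBound` and its stability under convolution -/

section LorentzProduct

variable {d : ℕ}

/-- Every finite set of grid points lies in the box spanned by its coordinate projections, where the
sum of products factorizes. -/
theorem summable_prod_of_tsum_le {f : Fin d → ℤ → ℝ} {B : ℝ} (h0 : ∀ j n, 0 ≤ f j n)
    (hs : ∀ j, Summable (f j)) (hB : ∀ j, ∑' n, f j n ≤ B) :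
    Summable (fun η : Grid d => ∏ j, f j (η j)) ∧ ∑' η : Grid d, ∏ j, f j (η j) ≤ B ^ d := by
  have h : ∀ s : Finset (Grid d), ∑ η ∈ s, ∏ j, f j (η j) ≤ B ^ d := by
    intro s
    classical
    calc ∑ η ∈ s, ∏ j, f j (η j)
        ≤ ∑ η ∈ Fintype.piFinset fun j => s.image fun η => η j, ∏ j, f j (η j) := by
          refine Finset.sum_le_sum_of_subset_of_nonneg (fun η hη => ?_)
            fun η _ _ => Finset.prod_nonneg fun j _ => h0 j _
          exact Fintype.mem_piFinset.2 fun j => Finset.mem_image_of_mem _ hη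
      _ = ∏ j, ∑ n ∈ s.image fun η => η j, f j n := (Finset.prod_univ_sum _ _).symm
      _ ≤ ∏ _j : Fin d, B := by
          refine Finset.prod_le_prod (fun j _ => Finset.sum_nonneg fun n _ => h0 j n) fun j _ => ?_
          exact ((hs j).sum_le_tsum _ fun n _ => h0 j n).trans (hB j)
      _ = B ^ d := by simp
  exact ⟨summable_of_sum_le (fun η => Finset.prod_nonneg fun j _ => h0 j _) h,
    Real.tsum_le_of_sum_le (fun η => Finset.prod_nonneg fun j _ => h0 j _) h⟩

/-- The comparison kernel on the grid. -/
def heatBound (dx t : ℝ) (α : Grid d) : ℝ := ∏ j, dx⁻¹ * lorentzKernel (√t / dx) (α j)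

variable {dx : ℝ}

theorem heatBound_pos (hdx : 0 < dx) {t : ℝ} (ht : 0 < t) (α : Grid d) : 0 < heatBound dx t α := by
  have := Real.sqrt_pos.2 ht
  exact Finset.prod_pos fun j _ => mul_pos (inv_pos.2 hdx) (lorentzKernel_pos (by positivity) _)

theorem heatBound_le (hdx : 0 < dx) {t : ℝ} (ht : 0 < t) (α : Grid d) :
    heatBound dx t α ≤ (√t)⁻¹ ^ d := by
  have h := Real.sqrt_pos.2 ht
  refine (Finset.prod_le_prod (g := fun _ => (√t)⁻¹) (fun j _ => (mul_pos (inv_pos.2 hdx)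
    (lorentzKernel_pos (by positivity) _)).le) fun j _ => ?_).trans_eq (by simp)
  have h1 := (lorentzKernel_le_min (ρ := √t / dx) (by positivity) (α j)).trans (min_le_right _ _)
  calc dx⁻¹ * lorentzKernel (√t / dx) (α j) ≤ dx⁻¹ * (1 / (√t / dx)) := by gcongr
    _ = (√t)⁻¹ := by field_simp

theorem summable_heatBound (hdx : 0 < dx) {t : ℝ} (ht : 0 < t) :
    Summable (fun η : Grid d => heatBound dx t η * dx ^ d) ∧
      ∑' η : Grid d, heatBound dx t η * dx ^ d ≤ 5 ^ d := by
  have hr : 0 < √t / dx := div_pos (Real.sqrt_pos.2 ht) hdx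
  obtain ⟨h1, h2⟩ := summable_lorentzKernel hr
  have := summable_prod_of_tsum_le (d := d) (f := fun _ => lorentzKernel (√t / dx)) (B := 5)
    (fun _ n => (lorentzKernel_pos hr n).le) (fun _ => h1) fun _ => h2
  have e : ∀ η : Grid d, heatBound dx t η * dx ^ d = ∏ j, lorentzKernel (√t / dx) (η j) := by
    intro η
    rw [heatBound, Finset.prod_mul_distrib]
    simp only [Finset.prod_const, Finset.card_univ, Fintype.card_fin]
    rw [inv_pow, mul_right_comm, inv_mul_cancel₀ (by positivity), one_mul]
  simpa only [e] using this

/-- The one-dimensional inequality is applied in each coordinate: `80 = 8 · 10`, with `10 = 5 + 5`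
the masses of the two Lorentz kernels. -/
theorem summable_heatBound_mul (hdx : 0 < dx) {s t : ℝ} (hs : 0 < s) (hst : s < t)
    (α β : Grid d) :
    Summable (fun η : Grid d =>
      heatBound dx (t - s) (α - η) * heatBound dx s (η - β) * dx ^ d) ∧
    ∑' η : Grid d, heatBound dx (t - s) (α - η) * heatBound dx s (η - β) * dx ^ d
      ≤ 80 ^ d * heatBound dx t (α - β) := by
  have hts : 0 < t - s := by linarith
  have ht : 0 < t := by linarith
  set ρ₁ := √(t - s) / dx
  set ρ₂ := √s / dx
  set r := √t / dx
  have h1 : 0 < ρ₁ := div_pos (Real.sqrt_pos.2 hts) hdx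
  have h2 : 0 < ρ₂ := div_pos (Real.sqrt_pos.2 hs) hdx
  have hr : 0 < r := div_pos (Real.sqrt_pos.2 ht) hdx
  have hrr : r ^ 2 = ρ₁ ^ 2 + ρ₂ ^ 2 := by
    simp only [r, ρ₁, ρ₂, div_pow, Real.sq_sqrt hts.le, Real.sq_sqrt hs.le, Real.sq_sqrt ht.le]
    ring
  obtain ⟨s1, b1⟩ := summable_lorentzKernel h1
  obtain ⟨s2, b2⟩ := summable_lorentzKernel h2
  let f : Fin d → ℤ → ℝ := fun j m => lorentzKernel ρ₁ (α j - m) + lorentzKernel ρ₂ (m - β j)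
  have f1 : ∀ j, Summable fun m => lorentzKernel ρ₁ (α j - m) := fun j =>
    ((Equiv.subLeft (α j)).summable_iff (f := lorentzKernel ρ₁)).2 s1
  have f2 : ∀ j, Summable fun m => lorentzKernel ρ₂ (m - β j) := fun j =>
    ((Equiv.subRight (β j)).summable_iff (f := lorentzKernel ρ₂)).2 s2
  have g1 : ∀ j, ∑' m, lorentzKernel ρ₁ (α j - m) ≤ 5 := fun j =>
    ((Equiv.subLeft (α j)).tsum_eq (lorentzKernel ρ₁)).trans_le b1
  have g2 : ∀ j, ∑' m, lorentzKernel ρ₂ (m - β j) ≤ 5 := fun j =>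
    ((Equiv.subRight (β j)).tsum_eq (lorentzKernel ρ₂)).trans_le b2
  obtain ⟨hS, hT⟩ := summable_prod_of_tsum_le (f := f) (B := 10)
    (fun j n => (add_pos (lorentzKernel_pos h1 _) (lorentzKernel_pos h2 _)).le)
    (fun j => (f1 j).add (f2 j)) fun j => by
      simp only [f]
      rw [(f1 j).tsum_add (f2 j)]
      linarith [g1 j, g2 j]
  have hle : ∀ η : Grid d, heatBound dx (t - s) (α - η) * heatBound dx s (η - β) * dx ^ d
      ≤ 8 ^ d * heatBound dx t (α - β) * ∏ j, f j (η j) := by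
    intro η
    have e1 : heatBound dx (t - s) (α - η) * heatBound dx s (η - β) * dx ^ d
        = ∏ j, dx⁻¹ * (lorentzKernel ρ₁ (α j - η j) * lorentzKernel ρ₂ (η j - β j)) := by
      simp only [heatBound, Finset.prod_mul_distrib, Finset.prod_const, Finset.card_univ,
        Fintype.card_fin, Pi.sub_apply]
      have hd : dx⁻¹ ^ d * dx ^ d = 1 := by
        rw [inv_pow, inv_mul_cancel₀ (by positivity)]
      linear_combination (dx⁻¹ ^ d * (∏ j, lorentzKernel ρ₁ (α j - η j))
        * ∏ j, lorentzKernel ρ₂ (η j - β j)) * hd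
    have e2 : 8 ^ d * heatBound dx t (α - β) * ∏ j, f j (η j)
        = ∏ j, dx⁻¹ * (8 * lorentzKernel r (α j - β j) * f j (η j)) := by
      simp only [heatBound, Finset.prod_mul_distrib, Finset.prod_const, Finset.card_univ,
        Fintype.card_fin, Pi.sub_apply]
      ring
    rw [e1, e2]
    refine Finset.prod_le_prod (fun j _ => ?_) fun j _ => ?_
    · exact mul_nonneg (inv_pos.2 hdx).le
        (mul_pos (lorentzKernel_pos h1 _) (lorentzKernel_pos h2 _)).le
    · refine mul_le_mul_of_nonneg_left ?_ (inv_pos.2 hdx).le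
      have := lorentzKernel_mul_le h1 h2 hr hrr (α j - β j) (η j - β j)
      rwa [sub_sub_sub_cancel_right] at this
  have h0 : ∀ η : Grid d, 0 ≤ heatBound dx (t - s) (α - η) * heatBound dx s (η - β) * dx ^ d :=
    fun η => mul_nonneg (mul_nonneg (heatBound_pos hdx hts _).le (heatBound_pos hdx hs _).le)
      (by positivity)
  have hS' := hS.mul_left (8 ^ d * heatBound dx t (α - β))
  have hSum := Summable.of_nonneg_of_le h0 hle hS'
  refine ⟨hSum, (hSum.tsum_le_tsum hle hS').trans ?_⟩
  rw [tsum_mul_left]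
  have := heatBound_pos hdx ht (α - β)
  calc 8 ^ d * heatBound dx t (α - β) * ∑' η : Grid d, ∏ j, f j (η j)
      ≤ 8 ^ d * heatBound dx t (α - β) * 10 ^ d := by gcongr
    _ = (8 * 10) ^ d * heatBound dx t (α - β) := by rw [mul_pow]; ring
    _ = _ := by norm_num

theorem abs_dconv_le (hdx : 0 < dx) {s t a b : ℝ} (hs : 0 < s) (hst : s < t) (ha : 0 ≤ a)
    {F G : Grid d → Grid d → ℝ}
    (hF : ∀ α β, |F α β| ≤ a * heatBound dx (t - s) (α - β))
    (hG : ∀ α β, |G α β| ≤ b * heatBound dx s (α - β)) (α β : Grid d) :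
    |dconv dx F G α β| ≤ a * b * (80 ^ d * heatBound dx t (α - β)) := by
  have hb : 0 ≤ b := by
    have := (abs_nonneg _).trans (hG α β)
    exact nonneg_of_mul_nonneg_left this (heatBound_pos hdx hs _)
  obtain ⟨h1, h2⟩ := summable_heatBound_mul hdx hs hst α β
  have hle : ∀ η, ‖F α η * G η β * dx ^ d‖
      ≤ a * b * (heatBound dx (t - s) (α - η) * heatBound dx s (η - β) * dx ^ d) := by
    intro η
    have hp := (heatBound_pos hdx (sub_pos.2 hst) (α - η)).le
    rw [norm_mul, norm_mul, Real.norm_of_nonneg (by positivity : 0 ≤ dx ^ d)]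
    calc ‖F α η‖ * ‖G η β‖ * dx ^ d
        ≤ (a * heatBound dx (t - s) (α - η)) * (b * heatBound dx s (η - β)) * dx ^ d := by
          gcongr
          · exact hF α η
          · exact hG η β
      _ = _ := by ring
  have h3 := tsum_of_norm_bounded (h1.mul_left (a * b)).hasSum hle
  rw [tsum_mul_left] at h3
  exact h3.trans (mul_le_mul_of_nonneg_left h2 (mul_nonneg ha hb))

end LorentzProduct

/-! ### Pointwise bounds on the parametrix and its error kernel -/

section KernelBounds

/-- For `n ≠ 0` the claims are multiplied by `ρ² + a²` and the two parts are estimated separately,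
with a split at `a = ρ` wherever a moment is missing. The bounds weighted by `a` exist to absorb the
Lipschitz factor of the coefficients. -/
theorem le_lorentzKernel_of_moments {ρ C a q Δ : ℝ} {n : ℤ} (hρ : 0 < ρ) (hC : 0 < C)
    (ha : a = |(n : ℝ)|) (hq0 : 0 ≤ q) (hΔ0 : 0 ≤ Δ)
    (hq : q ≤ C) (hq1 : q * ρ ≤ C) (hq3 : a ^ 3 * q ≤ C * ρ ^ 2)
    (hΔ : Δ ≤ C) (hΔ1 : Δ * ρ ^ 3 ≤ C) (hΔ2 : a ^ 2 * Δ * ρ ≤ C) (hΔ3 : a ^ 3 * Δ ≤ C) :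
    q ≤ 2 * C * lorentzKernel ρ n ∧ a * q ≤ 2 * C * ρ * lorentzKernel ρ n ∧
      Δ * ρ ^ 2 ≤ 2 * C * lorentzKernel ρ n ∧ a * Δ * ρ ≤ 2 * C * lorentzKernel ρ n := by
  by_cases hn : n = 0
  · subst hn
    have ha0 : a = 0 := by rw [ha]; simp
    have hmin : ∀ x : ℝ, x ≤ C → x * ρ ≤ C → x ≤ 2 * C * lorentzKernel ρ 0 := by
      intro x h1 h2
      rw [lorentzKernel, if_pos rfl]
      rcases min_choice 1 (1 / ρ) with e | e
      · rw [e]; linarith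
      · rw [e, mul_one_div, le_div_iff₀ hρ]; linarith
    have hpos := lorentzKernel_pos hρ 0
    refine ⟨hmin q hq hq1, ?_, hmin _ ?_ ?_, ?_⟩
    · rw [ha0, zero_mul]; positivity
    · rcases le_total ρ 1 with h | h
      · calc Δ * ρ ^ 2 ≤ C * 1 := by gcongr; exact pow_le_one₀ hρ.le h
          _ = C := mul_one C
      · refine le_trans ?_ hΔ1
        gcongr
        norm_num
    · rw [mul_assoc, ← pow_succ]; exact hΔ1
    · rw [ha0, zero_mul, zero_mul]; positivity
  · have ha1 : 1 ≤ a := by rw [ha]; exact_mod_cast Int.one_le_abs hn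
    have ha2 : (n : ℝ) ^ 2 = a ^ 2 := by rw [ha, sq_abs]
    have ha0 : 0 < a := by linarith
    have hD : 0 < ρ ^ 2 + a ^ 2 := by positivity
    have e : lorentzKernel ρ n = ρ / (ρ ^ 2 + a ^ 2) := by rw [lorentzKernel, if_neg hn, ha2]
    have hle : ∀ x K : ℝ, x * ρ ^ 2 ≤ K * C * ρ → x * a ^ 2 ≤ K * C * ρ →
        x ≤ 2 * C * K * lorentzKernel ρ n := by
      intro x K h1 h2
      rw [e, ← mul_div_assoc, le_div_iff₀ hD]
      linarith
    refine ⟨?_, ?_, ?_, ?_⟩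
    · have := hle q 1 (by nlinarith) (by
        rcases le_total a ρ with h | h
        · calc q * a ^ 2 ≤ q * ρ ^ 2 := by gcongr
            _ = q * ρ * ρ := by ring
            _ ≤ 1 * C * ρ := by rw [one_mul]; gcongr
        · refine le_of_mul_le_mul_right ?_ ha0
          calc q * a ^ 2 * a = a ^ 3 * q := by ring
            _ ≤ C * ρ * ρ := by linarith
            _ ≤ 1 * C * ρ * a := by rw [one_mul]; gcongr)
      linarith
    · refine hle (a * q) ρ ?_ ?_
      · rcases le_total a ρ with h | h
        · calc a * q * ρ ^ 2 = a * (q * ρ) * ρ := by ring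
            _ ≤ ρ * C * ρ := by gcongr
        · calc a * q * ρ ^ 2 ≤ a * q * a ^ 2 := by gcongr
            _ = a ^ 3 * q := by ring
            _ ≤ ρ * C * ρ := by linarith
      · linarith
    · have := hle (Δ * ρ ^ 2) 1 (by nlinarith) (by nlinarith)
      linarith
    · have := hle (a * Δ * ρ) 1 (by
        rw [one_mul]
        have h3 : a * Δ * ρ ^ 2 ≤ C := by
          rcases le_total a ρ with h | h
          · calc a * Δ * ρ ^ 2 ≤ ρ * Δ * ρ ^ 2 := by gcongr
              _ = Δ * ρ ^ 3 := by ring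
              _ ≤ C := hΔ1
          · calc a * Δ * ρ ^ 2 ≤ a * Δ * a ^ 2 := by gcongr
              _ = a ^ 3 * Δ := by ring
              _ ≤ C := hΔ3
        nlinarith) (by nlinarith)
      linarith

/-- The random walk kernel and its second difference are dominated by `lorentzKernel`. -/
theorem exists_walkKernel_le_lorentzKernel {cmin cmax : ℝ} (hcmin : 0 < cmin) :
    ∃ C : ℝ, 0 < C ∧ ∀ (k ρ : ℝ) (n : ℤ), cmin ≤ k → k ≤ cmax → 0 < ρ →
      |walkKernel n (k * ρ ^ 2)| ≤ C * lorentzKernel ρ n ∧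
      |(n : ℝ)| * |walkKernel n (k * ρ ^ 2)| ≤ C * ρ * lorentzKernel ρ n ∧
      |walkLap n (k * ρ ^ 2)| * ρ ^ 2 ≤ C * lorentzKernel ρ n ∧
      |(n : ℝ)| * |walkLap n (k * ρ ^ 2)| * ρ ≤ C * lorentzKernel ρ n := by
  have hM := momentConst_pos
  set M := momentConst
  set C : ℝ := 4 + M / √cmin + (20 * M + 2) * |cmax| + M / (cmin * √cmin) + 24 * M / √cmin
    + (76 * M + 2) with hCdef
  have hs := Real.sqrt_pos.2 hcmin
  have p1 : 0 < M / √cmin := by positivity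
  have p2 : 0 ≤ (20 * M + 2) * |cmax| := by positivity
  have p3 : 0 < M / (cmin * √cmin) := by positivity
  have p4 : 0 < 24 * M / √cmin := by positivity
  have hC : 0 < C := by positivity
  refine ⟨2 * C, by positivity, fun k ρ n hk1 hk2 hρ => ?_⟩
  have hk : 0 < k := by linarith
  have hτ : 0 < k * ρ ^ 2 := by positivity
  have hsq : √(k * ρ ^ 2) = √k * ρ := by rw [Real.sqrt_mul hk.le, Real.sqrt_sq hρ.le]
  have hsk : √cmin ≤ √k := Real.sqrt_le_sqrt hk1
  have hsk0 : 0 < √k := by linarith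
  refine le_lorentzKernel_of_moments hρ hC rfl (abs_nonneg _) (abs_nonneg _) ?_ ?_ ?_ ?_ ?_ ?_ ?_
  · have := abs_walkKernel_le_one n hτ.le
    linarith
  · have h := abs_walkKernel_le n hτ
    rw [hsq] at h
    calc |walkKernel n (k * ρ ^ 2)| * ρ ≤ M / (√k * ρ) * ρ := by gcongr
      _ = M / √k := by field_simp
      _ ≤ M / √cmin := by gcongr
      _ ≤ C := by linarith
  · have h := abs_cube_mul_walkKernel_le n hτ
    calc _ ≤ (20 * M + 2) * (k * ρ ^ 2) := h
      _ ≤ (20 * M + 2) * (|cmax| * ρ ^ 2) := by gcongr; exact hk2.trans (le_abs_self _)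
      _ = (20 * M + 2) * |cmax| * ρ ^ 2 := by ring
      _ ≤ C * ρ ^ 2 := by gcongr; linarith
  · have := abs_walkLap_le_four n hτ.le
    linarith
  · have h := abs_walkLap_le n hτ
    rw [hsq] at h
    calc |walkLap n (k * ρ ^ 2)| * ρ ^ 3 ≤ M / (k * ρ ^ 2 * (√k * ρ)) * ρ ^ 3 := by gcongr
      _ = M / (k * √k) := by field_simp
      _ ≤ M / (cmin * √cmin) := by gcongr
      _ ≤ C := by linarith
  · have h := (walkLap_moments n hτ).1
    rw [hsq] at h
    calc |(n : ℝ)| ^ 2 * |walkLap n (k * ρ ^ 2)| * ρ ≤ 24 * M / (√k * ρ) * ρ := by gcongr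
      _ = 24 * M / √k := by field_simp
      _ ≤ 24 * M / √cmin := by gcongr
      _ ≤ C := by linarith
  · have h := (walkLap_moments n hτ).2
    linarith

variable {d : ℕ}

theorem norm_gridPoint_sub_le {dx : ℝ} (hdx : 0 < dx) (α β : Grid d) :
    ‖gridPoint dx α - gridPoint dx β‖ ≤ ∑ k, |((α k - β k : ℤ) : ℝ)| * dx := by
  have e : gridPoint dx α - gridPoint dx β
      = ∑ k, EuclideanSpace.single k (((α k - β k : ℤ) : ℝ) * dx) := by
    ext i
    simp [gridPoint, sub_mul]
  rw [e]
  refine (norm_sum_le _ _).trans (Finset.sum_le_sum fun k _ => ?_)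
  rw [PiLp.norm_single, norm_mul, Real.norm_eq_abs, Real.norm_of_nonneg hdx.le]

/-- The pointwise bounds on `parametrix` and `errKernel`. -/
theorem exists_parametrix_errKernel_le (d : ℕ) {cmin cmax : ℝ} (L : ℝ) (hcmin : 0 < cmin) :
    ∃ C M : ℝ, 0 < C ∧ 0 < M ∧ ∀ (dx : ℝ) (c : Grid d → Fin d → ℝ), 0 < dx →
      Admissible dx c cmin cmax L → ∀ t : ℝ, 0 < t → ∀ α β : Grid d,
        |parametrix dx c t α β| ≤ C * heatBound dx t (α - β) ∧
        |errKernel dx c t α β| ≤ M * (√t)⁻¹ * heatBound dx t (α - β) := by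
  obtain ⟨C, hC, hw⟩ := exists_walkKernel_le_lorentzKernel (cmax := cmax) hcmin
  -- The factor `d * d` counts pairs of a differentiated direction and a coordinate of `x_α - x_β`;
  -- the summand `1` keeps the constant positive when `L = 0`.
  refine ⟨C ^ d, |L| * (d * d) * C ^ d + 1, by positivity, by positivity,
    fun dx c hdx hadm t ht α β => ?_⟩
  have hc0 : ∀ α j, 0 ≤ c α j := fun α j => hcmin.le.trans (hadm.lower α j)
  have hst := Real.sqrt_pos.2 ht
  set ρ := √t / dx with hρdef
  have hρ : 0 < ρ := by positivity
  have hτ : ∀ j, c β j * t / dx ^ 2 = c β j * ρ ^ 2 := by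
    intro j
    rw [hρdef, div_pow, Real.sq_sqrt ht.le, mul_div_assoc]
  have hw' := fun i => hw (c β i) ρ (α i - β i) (hadm.lower β i) (hadm.upper β i) hρ
  have hl : ∀ i, 0 < lorentzKernel ρ (α i - β i) := fun i => lorentzKernel_pos hρ _
  have hH : heatBound dx t (α - β) = ∏ i, dx⁻¹ * lorentzKernel ρ (α i - β i) := rfl
  constructor
  · rw [parametrix, frozenKernel_eq_prod hdx hc0 ht.le, Finset.abs_prod, hH]
    have e : C ^ d * ∏ i, dx⁻¹ * lorentzKernel ρ (α i - β i)
        = ∏ i, C * (dx⁻¹ * lorentzKernel ρ (α i - β i)) := by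
      rw [Finset.prod_mul_distrib (f := fun _ => C)]; simp
    rw [e]
    refine Finset.prod_le_prod (fun _ _ => abs_nonneg _) fun i _ => ?_
    rw [abs_mul, abs_of_pos (inv_pos.2 hdx), hτ, mul_left_comm]
    exact mul_le_mul_of_nonneg_left (hw' i).1 (inv_pos.2 hdx).le
  · set q : Fin d → ℝ := fun i => |walkKernel (α i - β i) (c β i * ρ ^ 2)| with hq
    set D : Fin d → ℝ := fun i => |walkLap (α i - β i) (c β i * ρ ^ 2)| with hD
    set a : Fin d → ℝ := fun i => |((α i - β i : ℤ) : ℝ)| with ha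
    set H := heatBound dx t (α - β) with hHdef
    have hHpos : 0 < H := heatBound_pos hdx ht _
    -- The distance in coordinate `k` costs a factor `ρ` and the second difference in coordinate `j`
    -- gains `ρ⁻²`, so the net factor is `ρ⁻¹ = dx / √t`. The four cases are whether a coordinate
    -- equals `k`, `j`, both or neither.
    have key : ∀ j k, a k * (dx⁻¹ * D j * ∏ i ∈ Finset.univ.erase j, dx⁻¹ * q i)
        ≤ C ^ d * ρ⁻¹ * H := by
      intro j k
      have e1 : a k * (dx⁻¹ * D j * ∏ i ∈ Finset.univ.erase j, dx⁻¹ * q i)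
          = ∏ i, (if i = k then a i else 1) * (dx⁻¹ * if i = j then D i else q i) := by
        rw [Finset.prod_mul_distrib (f := fun i => if i = k then a i else 1),
          Finset.prod_ite_eq' Finset.univ k a,
          if_pos (Finset.mem_univ k), ← Finset.mul_prod_erase _ _ (Finset.mem_univ j), if_pos rfl]
        congr 2
        exact Finset.prod_congr rfl fun i hi => by rw [if_neg (Finset.ne_of_mem_erase hi)]
      have e2 : C ^ d * ρ⁻¹ * H = ∏ i, C * (dx⁻¹ * lorentzKernel ρ (α i - β i))
          * ((if i = k then ρ else 1) * if i = j then (ρ ^ 2)⁻¹ else 1) := by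
        rw [Finset.prod_mul_distrib (f := fun i => C * (dx⁻¹ * lorentzKernel ρ (α i - β i))),
          Finset.prod_mul_distrib (f := fun _ => C), ← hH,
          Finset.prod_mul_distrib (f := fun i => if i = k then ρ else 1),
          Finset.prod_ite_eq' Finset.univ k fun _ => ρ,
          Finset.prod_ite_eq' Finset.univ j fun _ => (ρ ^ 2)⁻¹, if_pos (Finset.mem_univ k),
          if_pos (Finset.mem_univ j)]
        simp only [Finset.prod_const, Finset.card_univ, Fintype.card_fin]
        field_simp
      rw [e1, e2]
      refine Finset.prod_le_prod (fun i _ => ?_) fun i _ => ?_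
      · split_ifs <;> positivity
      · obtain ⟨w1, w2, w3, w4⟩ := hw' i
        have hx := inv_pos.2 hdx
        set l := lorentzKernel ρ (α i - β i)
        split_ifs
        · calc a i * (dx⁻¹ * D i) = dx⁻¹ * (a i * D i * ρ) * ρ⁻¹ := by field_simp
            _ ≤ dx⁻¹ * (C * l) * ρ⁻¹ := by gcongr
            _ = _ := by field_simp
        · calc a i * (dx⁻¹ * q i) = dx⁻¹ * (a i * q i) := by ring
            _ ≤ dx⁻¹ * (C * ρ * l) := by gcongr
            _ = _ := by ring
        · calc 1 * (dx⁻¹ * D i) = dx⁻¹ * (D i * ρ ^ 2) * (ρ ^ 2)⁻¹ := by field_simp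
            _ ≤ dx⁻¹ * (C * l) * (ρ ^ 2)⁻¹ := by gcongr
            _ = _ := by ring
        · calc 1 * (dx⁻¹ * q i) = dx⁻¹ * q i := one_mul _
            _ ≤ dx⁻¹ * (C * l) := by gcongr
            _ = _ := by ring
    have hterm : ∀ j, |(c α j - c β j) *
        nablaPlus dx j (nablaMinus dx j fun γ => parametrix dx c t γ β) α|
          ≤ d * (|L| * dx * (dx ^ 2)⁻¹ * (C ^ d * ρ⁻¹ * H)) := by
      intro j
      rw [nablaPlus_nablaMinus_parametrix hdx hc0 ht.le, abs_mul, abs_mul, abs_mul, abs_mul,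
        Finset.abs_prod, abs_of_pos (by positivity : 0 < (dx ^ 2)⁻¹), abs_of_pos (inv_pos.2 hdx)]
      simp only [abs_mul, abs_of_pos (inv_pos.2 hdx), hτ]
      have hL : |c α j - c β j| ≤ |L| * ∑ k, a k * dx :=
        (hadm.lipschitz α β j).trans (mul_le_mul (le_abs_self L) (norm_gridPoint_sub_le hdx α β)
          (norm_nonneg _) (abs_nonneg _))
      set X := dx⁻¹ * D j * ∏ i ∈ Finset.univ.erase j, dx⁻¹ * q i with hX
      have hX0 : 0 ≤ X := by positivity
      calc |c α j - c β j| * ((dx ^ 2)⁻¹ * X)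
          ≤ (|L| * ∑ k, a k * dx) * ((dx ^ 2)⁻¹ * X) := by gcongr
        _ = ∑ k, |L| * dx * (dx ^ 2)⁻¹ * (a k * X) := by
            rw [Finset.mul_sum, Finset.sum_mul]
            exact Finset.sum_congr rfl fun k _ => by ring
        _ ≤ ∑ _k : Fin d, |L| * dx * (dx ^ 2)⁻¹ * (C ^ d * ρ⁻¹ * H) :=
            Finset.sum_le_sum fun k _ =>
              mul_le_mul_of_nonneg_left (key j k) (by positivity)
        _ = _ := by simp
    rw [errKernel]
    refine (Finset.abs_sum_le_sum_abs _ _).trans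
      ((Finset.sum_le_sum fun j _ => hterm j).trans ?_)
    rw [Finset.sum_const, Finset.card_univ, Fintype.card_fin, nsmul_eq_mul]
    have e : (d : ℝ) * (d * (|L| * dx * (dx ^ 2)⁻¹ * (C ^ d * ρ⁻¹ * H)))
        = |L| * (d * d) * C ^ d * (√t)⁻¹ * H := by
      rw [hρdef]; field_simp
    rw [e]
    gcongr
    linarith

end KernelBounds

/-! ### Summation of Levi's series with constants uniform in `dx` -/

section Iteration

theorem exp_neg_le_rpow {x : ℝ} (hx : 0 < x) : Real.exp (-x) ≤ x ^ (-(1 / 4) : ℝ) := by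
  rw [Real.exp_neg, Real.rpow_neg hx.le]
  refine inv_anti₀ (by positivity) ?_
  have h1 : x ^ (1 / 4 : ℝ) ≤ 1 + x := by
    rcases le_total x 1 with h | h
    · have := Real.rpow_le_one hx.le h (by norm_num : (0 : ℝ) ≤ 1 / 4)
      linarith
    · have := Real.rpow_le_rpow_of_exponent_le h (by norm_num : (1 / 4 : ℝ) ≤ 1)
      rw [Real.rpow_one] at this
      linarith
  linarith [Real.add_one_le_exp x]

theorem inv_sqrt_eq_rpow {x : ℝ} (hx : 0 ≤ x) : (√x)⁻¹ = x ^ (-(1 / 2) : ℝ) := by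
  rw [Real.rpow_neg hx, Real.sqrt_eq_rpow]

theorem inv_sqrt_le_two_mul {s t : ℝ} (ht : 0 < t) (h : t ≤ 4 * s) : (√s)⁻¹ ≤ 2 * (√t)⁻¹ := by
  have hs : 0 < √s := Real.sqrt_pos.2 (by linarith)
  have ht' : 0 < √t := Real.sqrt_pos.2 ht
  have h1 : √t ≤ 2 * √s := Real.sqrt_le_iff.2 ⟨by positivity, by
    rw [mul_pow, Real.sq_sqrt (by linarith)]; linarith⟩
  rw [← one_div, ← div_eq_mul_inv, div_le_div_iff₀ hs ht']
  linarith

/-- The dominating function of the time singularities. -/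
def timeMajorant (t s : ℝ) : ℝ := (t - s) ^ (-(3 / 4) : ℝ) + s ^ (-(3 / 4) : ℝ)

/-- A quarter power of the exponential is traded for the small factor `lam^(-1/4)`. The larger of
`s` and `t - s` then yields `t^(-1/2)`, and the remaining singularity has the integrable exponent
`-3/4`. -/
theorem time_singularity_le {lam s t : ℝ} (hlam : 0 < lam) (hs : 0 < s) (hst : s < t) :
    Real.exp (-(lam * (t - s))) * (√(t - s))⁻¹ * (√s)⁻¹
      ≤ lam ^ (-(1 / 4) : ℝ) * (2 * (√t)⁻¹) * timeMajorant t s := by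
  have hr : 0 < t - s := by linarith
  have ht : 0 < t := by linarith
  have h1 := exp_neg_le_rpow (mul_pos hlam hr)
  rw [Real.mul_rpow hlam.le hr.le] at h1
  have hsplit : ∀ x : ℝ, 0 < x → x ^ (-(1 / 4) : ℝ) * (√x)⁻¹ = x ^ (-(3 / 4) : ℝ) := by
    intro x hx
    rw [inv_sqrt_eq_rpow hx.le, ← Real.rpow_add hx]; norm_num
  have pr : 0 < (t - s) ^ (-(3 / 4) : ℝ) := Real.rpow_pos_of_pos hr _
  have ps : 0 < s ^ (-(3 / 4) : ℝ) := Real.rpow_pos_of_pos hs _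
  have pt : 0 < (√t)⁻¹ := inv_pos.2 (Real.sqrt_pos.2 ht)
  have key : (t - s) ^ (-(3 / 4) : ℝ) * (√s)⁻¹ ≤ 2 * (√t)⁻¹ * timeMajorant t s := by
    unfold timeMajorant
    rcases le_total (t - s) s with h | h
    · have := inv_sqrt_le_two_mul (s := s) ht (by linarith)
      calc _ ≤ (t - s) ^ (-(3 / 4) : ℝ) * (2 * (√t)⁻¹) := by gcongr
        _ = 2 * (√t)⁻¹ * (t - s) ^ (-(3 / 4) : ℝ) := by ring
        _ ≤ _ := by gcongr; linarith
    · have h2 := inv_sqrt_le_two_mul (s := t - s) ht (by linarith)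
      have h3 : (t - s) ^ (-(1 / 4) : ℝ) ≤ s ^ (-(1 / 4) : ℝ) :=
        Real.rpow_le_rpow_of_nonpos hs h (by norm_num)
      have pq : 0 < s ^ (-(1 / 4) : ℝ) := Real.rpow_pos_of_pos hs _
      calc _ = (t - s) ^ (-(1 / 4) : ℝ) * (√(t - s))⁻¹ * (√s)⁻¹ := by rw [hsplit _ hr]
        _ ≤ s ^ (-(1 / 4) : ℝ) * (2 * (√t)⁻¹) * (√s)⁻¹ := by gcongr
        _ = 2 * (√t)⁻¹ * (s ^ (-(1 / 4) : ℝ) * (√s)⁻¹) := by ring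
        _ = 2 * (√t)⁻¹ * s ^ (-(3 / 4) : ℝ) := by rw [hsplit _ hs]
        _ ≤ _ := by gcongr; linarith
  have pl : 0 < lam ^ (-(1 / 4) : ℝ) := Real.rpow_pos_of_pos hlam _
  calc Real.exp (-(lam * (t - s))) * (√(t - s))⁻¹ * (√s)⁻¹
      ≤ lam ^ (-(1 / 4) : ℝ) * (t - s) ^ (-(1 / 4) : ℝ) * (√(t - s))⁻¹ * (√s)⁻¹ := by gcongr
    _ = lam ^ (-(1 / 4) : ℝ) * ((t - s) ^ (-(1 / 4) : ℝ) * (√(t - s))⁻¹ * (√s)⁻¹) := by ring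
    _ = lam ^ (-(1 / 4) : ℝ) * ((t - s) ^ (-(3 / 4) : ℝ) * (√s)⁻¹) := by rw [hsplit _ hr]
    _ ≤ lam ^ (-(1 / 4) : ℝ) * (2 * (√t)⁻¹ * timeMajorant t s) := by gcongr
    _ = _ := by ring

theorem integral_timeMajorant (t : ℝ) :
    IntervalIntegrable (timeMajorant t) MeasureTheory.volume 0 t ∧
      ∫ s in (0 : ℝ)..t, timeMajorant t s = 8 * t ^ (1 / 4 : ℝ) := by
  have i2 : IntervalIntegrable (fun s : ℝ => s ^ (-(3 / 4) : ℝ)) MeasureTheory.volume 0 t :=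
    intervalIntegral.intervalIntegrable_rpow' (by norm_num)
  have i1 : IntervalIntegrable (fun s : ℝ => (t - s) ^ (-(3 / 4) : ℝ))
      MeasureTheory.volume 0 t := by
    have := (i2.comp_sub_left t).symm
    simpa using this
  refine ⟨i1.add i2, ?_⟩
  unfold timeMajorant
  rw [intervalIntegral.integral_add i1 i2,
    intervalIntegral.integral_comp_sub_left (fun s : ℝ => s ^ (-(3 / 4) : ℝ)) t, sub_self,
    sub_zero, integral_rpow (Or.inl (by norm_num)), Real.zero_rpow (by norm_num)]
  norm_num
  ring

theorem integral_inv_sqrt {t : ℝ} (ht : 0 < t) :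
    IntervalIntegrable (fun s : ℝ => (√s)⁻¹) MeasureTheory.volume 0 t ∧
      ∫ s in (0 : ℝ)..t, (√s)⁻¹ = 2 * √t := by
  have e : ∀ s ∈ Set.uIcc 0 t, s ^ (-(1 / 2) : ℝ) = (√s)⁻¹ := fun s hs => by
    rw [Set.uIcc_of_le ht.le] at hs
    exact (inv_sqrt_eq_rpow hs.1).symm
  have i : IntervalIntegrable (fun s : ℝ => s ^ (-(1 / 2) : ℝ)) MeasureTheory.volume 0 t :=
    intervalIntegral.intervalIntegrable_rpow' (by norm_num)
  refine ⟨i.congr fun s hs => e s (Set.uIoc_subset_uIcc hs), ?_⟩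
  rw [← intervalIntegral.integral_congr e, integral_rpow (Or.inl (by norm_num)),
    Real.zero_rpow (by norm_num), Real.sqrt_eq_rpow]
  norm_num
  ring

variable {d : ℕ} {dx : ℝ} {c : Grid d → Fin d → ℝ}

/-- The kernel bounds require `t - s > 0`, so the endpoint `s = t` is discarded as a null set. -/
theorem ae_mem_Ioc_imp {t : ℝ} {p : ℝ → Prop} (h : ∀ s, 0 < s → s < t → p s) :
    ∀ᵐ s : ℝ, s ∈ Set.Ioc 0 t → p s := by
  filter_upwards [MeasureTheory.Measure.ae_ne MeasureTheory.volume t] with s hs hm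
  exact h s hm.1 (lt_of_le_of_ne hm.2 hs)

/-- The ratio of the geometric bound on the iterated kernels. -/
def iterRatio (d : ℕ) (M T lam : ℝ) : ℝ :=
  M * 80 ^ d * (lam ^ (-(1 / 4) : ℝ) * (16 * T ^ (1 / 4 : ℝ)))

/-- The weight `exp (lam t)` replaces the usual Beta-function bookkeeping: each convolution
reproduces the same space-time profile and costs the fixed ratio `iterRatio`, which a large `lam`
makes small. Its factor `16` is `2` from `time_singularity_le` times `8` from the integral of the
majorant. -/
theorem abs_iterKernel_le (hdx : 0 < dx) {M T lam : ℝ} (hM : 0 < M) (hlam : 0 < lam)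
    (hK : ∀ t, 0 < t → ∀ α β,
      |errKernel dx c t α β| ≤ M * (√t)⁻¹ * heatBound dx t (α - β)) (m : ℕ) :
    ∀ t, 0 < t → t ≤ T → ∀ α β, |iterKernel dx c m t α β|
      ≤ M * (√t)⁻¹ * Real.exp (lam * t) * iterRatio d M T lam ^ m * heatBound dx t (α - β) := by
  induction m with
  | zero =>
    intro t ht _ α β
    refine (hK t ht α β).trans ?_
    have hH := heatBound_pos hdx ht (α - β)
    have : 1 ≤ Real.exp (lam * t) := Real.one_le_exp (by positivity)
    rw [pow_zero, mul_one]
    exact mul_le_mul_of_nonneg_right (le_mul_of_one_le_right (by positivity) this) hH.le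
  | succ m ih =>
    intro t ht htT α β
    have hT : 0 < T := ht.trans_le htT
    have hε : 0 < iterRatio d M T lam := by unfold iterRatio; positivity
    set ε := iterRatio d M T lam with hεdef
    set H := heatBound dx t (α - β)
    have hH : 0 < H := heatBound_pos hdx ht (α - β)
    obtain ⟨hi, he⟩ := integral_timeMajorant t
    set Q : ℝ := M * M * ε ^ m * (80 ^ d * H) * Real.exp (lam * t)
      * (lam ^ (-(1 / 4) : ℝ) * (2 * (√t)⁻¹)) with hQ
    have hb := intervalIntegral.norm_integral_le_of_norm_le (μ := MeasureTheory.volume) ht.le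
      (f := fun s => dconv dx (errKernel dx c (t - s)) (iterKernel dx c m s) α β)
      (g := fun s => Q * timeMajorant t s) (ae_mem_Ioc_imp fun s hs hst => by
        have hts : 0 < t - s := by linarith
        refine (abs_dconv_le hdx hs hst (by positivity) (hK (t - s) hts)
          (ih s hs (by linarith)) α β).trans ?_
        have e1 : Real.exp (lam * s) = Real.exp (lam * t) * Real.exp (-(lam * (t - s))) := by
          rw [← Real.exp_add]; congr 1; ring
        have := time_singularity_le hlam hs hst
        calc _ = M * M * ε ^ m * (80 ^ d * H) * Real.exp (lam * t)
              * (Real.exp (-(lam * (t - s))) * (√(t - s))⁻¹ * (√s)⁻¹) := by rw [e1]; ring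
          _ ≤ M * M * ε ^ m * (80 ^ d * H) * Real.exp (lam * t)
              * (lam ^ (-(1 / 4) : ℝ) * (2 * (√t)⁻¹) * timeMajorant t s) := by gcongr
          _ = _ := by rw [hQ]; ring) (hi.const_mul Q)
    rw [intervalIntegral.integral_const_mul, he] at hb
    refine hb.trans ?_
    have hQ0 : 0 < Q := by positivity
    have hp : t ^ (1 / 4 : ℝ) ≤ T ^ (1 / 4 : ℝ) := by gcongr
    calc Q * (8 * t ^ (1 / 4 : ℝ)) ≤ Q * (8 * T ^ (1 / 4 : ℝ)) := by gcongr
      _ = M * (√t)⁻¹ * Real.exp (lam * t) * ε ^ m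
          * (M * 80 ^ d * (lam ^ (-(1 / 4) : ℝ) * (16 * T ^ (1 / 4 : ℝ)))) * H := by
            rw [hQ]; ring
      _ = _ := by rw [pow_succ, hεdef, iterRatio]; ring

/-- The resolvent kernel `Phi` satisfies the same bound as `errKernel`. -/
theorem exists_Phi_le (d : ℕ) {M T : ℝ} (hM : 0 < M) (hT : 0 < T) :
    ∃ B : ℝ, 0 < B ∧ ∀ (dx : ℝ) (c : Grid d → Fin d → ℝ), 0 < dx →
      (∃ N, ∀ a j, |c a j| ≤ N) →
      (∀ t, 0 < t → ∀ α β, |errKernel dx c t α β| ≤ M * (√t)⁻¹ * heatBound dx t (α - β)) →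
      ∀ t, 0 < t → t ≤ T → ∀ α β,
        |Phi dx c t α β| ≤ B * (√t)⁻¹ * heatBound dx t (α - β) := by
  set R : ℝ := 2 * (M * 80 ^ d * (16 * T ^ (1 / 4 : ℝ))) with hR
  have hR0 : 0 < R := by positivity
  -- The fourth power gives `lam^(-1/4) = R⁻¹`, so the ratio is exactly `1/2` and the geometric
  -- series sums to `2`.
  set lam : ℝ := R ^ 4 with hlam
  have hlam0 : 0 < lam := by positivity
  have hl : lam ^ (-(1 / 4) : ℝ) = R⁻¹ := by
    rw [hlam, ← Real.rpow_natCast, ← Real.rpow_mul hR0.le, ← Real.rpow_neg_one]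
    norm_num
  have hε : iterRatio d M T lam = 1 / 2 := by
    have hp : 0 < T ^ (1 / 4 : ℝ) := by positivity
    rw [iterRatio, hl, hR]; field_simp
  refine ⟨M * Real.exp (lam * T) * 2, by positivity, fun dx c hdx hc hK t ht htT α β => ?_⟩
  have hH := heatBound_pos hdx ht (α - β)
  have hg : HasSum (fun m : ℕ => M * Real.exp (lam * T) * (√t)⁻¹ * heatBound dx t (α - β)
      * (1 / 2 : ℝ) ^ m) (M * Real.exp (lam * T) * (√t)⁻¹ * heatBound dx t (α - β) * 2) :=
    hasSum_geometric_two.mul_left _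
  rw [Phi]
  have e : M * Real.exp (lam * T) * 2 * (√t)⁻¹ * heatBound dx t (α - β)
      = M * Real.exp (lam * T) * (√t)⁻¹ * heatBound dx t (α - β) * 2 := by ring
  rw [e]
  refine tsum_of_norm_bounded (f := fun m => iterKernel dx c m t α β) hg fun m => ?_
  refine (abs_iterKernel_le hdx hM hlam0 hK m t ht htT α β).trans ?_
  rw [hε]
  calc M * (√t)⁻¹ * Real.exp (lam * t) * (1 / 2) ^ m * heatBound dx t (α - β)
      ≤ M * (√t)⁻¹ * Real.exp (lam * T) * (1 / 2) ^ m * heatBound dx t (α - β) := by gcongr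
    _ = _ := by ring

/-- The correction term is one more convolution of `heatBound` with itself, with the time
singularity `s^(-1/2)` of `Phi` integrating to `2 √t`. -/
theorem exists_Gam_le_heatBound (d : ℕ) {cmin cmax : ℝ} (L : ℝ) (hcmin : 0 < cmin) {T : ℝ}
    (hT : 0 < T) :
    ∃ C : ℝ, 0 < C ∧ ∀ (dx : ℝ) (c : Grid d → Fin d → ℝ), 0 < dx →
      Admissible dx c cmin cmax L → ∀ t : ℝ, 0 < t → t ≤ T → ∀ α β : Grid d,
        |Gam dx c t α β| ≤ C * heatBound dx t (α - β) := by
  obtain ⟨A, M, hA, hM, hb⟩ := exists_parametrix_errKernel_le d (cmax := cmax) L hcmin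
  obtain ⟨B, hB, hΦ⟩ := exists_Phi_le d hM hT
  refine ⟨A + A * B * 80 ^ d * (2 * √T), by positivity, fun dx c hdx hadm t ht htT α β => ?_⟩
  have hP := fun t ht α β => (hb dx c hdx hadm t ht α β).1
  have hΦ' := hΦ dx c hdx hadm.bounded fun t ht α β => (hb dx c hdx hadm t ht α β).2
  set H := heatBound dx t (α - β)
  have hH : 0 < H := heatBound_pos hdx ht (α - β)
  obtain ⟨hi, he⟩ := integral_inv_sqrt ht
  have h := intervalIntegral.norm_integral_le_of_norm_le (μ := MeasureTheory.volume) ht.le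
    (f := fun s => dconv dx (parametrix dx c (t - s)) (Phi dx c s) α β)
    (g := fun s => A * B * (80 ^ d * H) * (√s)⁻¹) (ae_mem_Ioc_imp fun s hs hst => by
      refine (abs_dconv_le hdx hs hst hA.le (hP (t - s) (by linarith))
        (hΦ' s hs (by linarith)) α β).trans_eq ?_
      ring) (hi.const_mul _)
  rw [intervalIntegral.integral_const_mul, he] at h
  rw [Gam]
  refine (abs_add_le _ _).trans ((add_le_add (hP t ht α β) h).trans ?_)
  have hsq : √t ≤ √T := Real.sqrt_le_sqrt htT
  calc A * H + A * B * (80 ^ d * H) * (2 * √t) ≤ A * H + A * B * (80 ^ d * H) * (2 * √T) := by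
        gcongr
    _ = _ := by ring

end Iteration

/-! ### Comparison with the stated bound, and norm estimates -/

section FinalBounds

variable {d : ℕ} {dx : ℝ} {c : Grid d → Fin d → ℝ}

theorem Admissible.supCoeff_mem {cmin cmax L : ℝ} (hd : 1 ≤ d)
    (h : Admissible dx c cmin cmax L) : cmin ≤ supCoeff c ∧ supCoeff c ≤ cmax := by
  let p : Grid d × Fin d := (0, ⟨0, hd⟩)
  have : Nonempty (Grid d × Fin d) := ⟨p⟩
  have hb : BddAbove (Set.range fun p : Grid d × Fin d => c p.1 p.2) :=
    ⟨cmax, by rintro _ ⟨p, rfl⟩; exact h.upper _ _⟩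
  exact ⟨(h.lower p.1 p.2).trans (le_ciSup hb p), ciSup_le fun p => h.upper _ _⟩

theorem rpow_neg_half_eq {t : ℝ} (ht : 0 < t) (d : ℕ) : t ^ (-(d : ℝ) / 2) = (√t)⁻¹ ^ d := by
  rw [inv_sqrt_eq_rpow ht.le, ← Real.rpow_natCast, ← Real.rpow_mul ht.le]
  congr 1; ring

theorem lorentzBound_eq_prod {t : ℝ} (ht : 0 < t) (α β : Grid d) :
    lorentzBound dx c t α β = ∏ j,
      (if α j - β j = 0 then min (1 / √(2 * supCoeff c)) (√t / dx) else 1) * (√t)⁻¹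
        * (1 + ((α j - β j : ℤ) * dx : ℝ) ^ 2 / (2 * supCoeff c * t))⁻¹ := by
  rw [lorentzBound, Finset.prod_mul_distrib, Finset.prod_mul_distrib, rpow_neg_half_eq ht]
  congr 1
  · congr 1
    · rw [Finset.prod_ite, Finset.prod_const, Finset.prod_const_one, mul_one, numZeros]
      rfl
    · simp
  · refine Finset.prod_congr rfl fun j _ => ?_
    rw [sq_abs]
    congr 4
    simp only [gridPoint, Int.cast_sub]
    ring

/-- Coordinatewise comparison. In the constant, `√(2 cmax)` serves the vanishing coordinates where
the minimum is `1/√(2 c̄)`, `1/(2 cmin)` serves the tails of the others, and `1` covers the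
remaining cases. -/
theorem heatBound_le_lorentzBound {cmin cmax L : ℝ} (hd : 1 ≤ d) (hcmin : 0 < cmin)
    (hdx : 0 < dx) (h : Admissible dx c cmin cmax L) {t : ℝ} (ht : 0 < t) (α β : Grid d) :
    heatBound dx t (α - β)
      ≤ (1 + √(2 * cmax) + 1 / (2 * cmin)) ^ d * lorentzBound dx c t α β := by
  obtain ⟨hk1, hk2⟩ := h.supCoeff_mem hd
  set κ := supCoeff c with hκ
  set C := 1 + √(2 * cmax) + 1 / (2 * cmin) with hC
  have hκ0 : 0 < κ := by linarith
  have hs := Real.sqrt_pos.2 ht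
  have hsq := Real.sq_sqrt ht.le
  have hC1 : 1 ≤ C := by
    have : 0 < 1 / (2 * cmin) := by positivity
    linarith [Real.sqrt_nonneg (2 * cmax)]
  have hC2 : √(2 * κ) ≤ C := by
    have : 0 < 1 / (2 * cmin) := by positivity
    have := Real.sqrt_le_sqrt (show 2 * κ ≤ 2 * cmax by linarith)
    linarith
  have hC3 : 1 ≤ C * (2 * κ) := by
    have h1 : 1 / (2 * cmin) ≤ C := by linarith [Real.sqrt_nonneg (2 * cmax)]
    calc 1 = 1 / (2 * cmin) * (2 * cmin) := by field_simp
      _ ≤ C * (2 * κ) := by gcongr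
  have e : C ^ d = ∏ _j : Fin d, C := by simp
  rw [lorentzBound_eq_prod ht, heatBound, e, ← Finset.prod_mul_distrib]
  refine Finset.prod_le_prod (fun j _ => mul_nonneg (inv_pos.2 hdx).le
    (lorentzKernel_pos (by positivity) _).le) fun j _ => ?_
  rw [Pi.sub_apply, lorentzKernel]
  split_ifs with hn
  · rw [hn, Int.cast_zero, zero_mul, zero_pow two_ne_zero, zero_div, add_zero, inv_one, mul_one]
    have hκs : 0 < √(2 * κ) := Real.sqrt_pos.2 (by positivity)
    rcases min_choice (1 / √(2 * κ)) (√t / dx) with e | e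
    · rw [e]
      calc dx⁻¹ * min 1 (1 / (√t / dx)) ≤ dx⁻¹ * (1 / (√t / dx)) := by
            gcongr; exact min_le_right _ _
        _ = √(2 * κ) * (1 / √(2 * κ) * (√t)⁻¹) := by field_simp
        _ ≤ C * (1 / √(2 * κ) * (√t)⁻¹) := by gcongr
    · rw [e]
      calc dx⁻¹ * min 1 (1 / (√t / dx)) ≤ dx⁻¹ * 1 := by gcongr; exact min_le_left _ _
        _ = 1 * (√t / dx * (√t)⁻¹) := by field_simp
        _ ≤ C * (√t / dx * (√t)⁻¹) := by gcongr
  · set n : ℝ := ((α j - β j : ℤ) : ℝ)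
    have e1 : dx⁻¹ * (√t / dx / ((√t / dx) ^ 2 + n ^ 2)) = √t / (t + (n * dx) ^ 2) := by
      rw [div_pow, hsq]; field_simp
    have e2 : C * (1 * (√t)⁻¹ * (1 + (n * dx) ^ 2 / (2 * κ * t))⁻¹)
        = √t * (C * (2 * κ)) / (2 * κ * t + (n * dx) ^ 2) := by
      have : 1 + (n * dx) ^ 2 / (2 * κ * t) = (2 * κ * t + (n * dx) ^ 2) / (2 * κ * t) := by
        field_simp
      rw [this, inv_div]
      nth_rewrite 2 [← hsq]
      field_simp
    rw [e1, e2, div_le_div_iff₀ (by positivity) (by positivity), mul_assoc (√t)]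
    refine mul_le_mul_of_nonneg_left ?_ hs.le
    have h1 : 2 * κ * t ≤ C * (2 * κ) * t := by
      have : 0 < 2 * κ * t := by positivity
      nlinarith
    have h2 : (n * dx) ^ 2 ≤ C * (2 * κ) * (n * dx) ^ 2 := le_mul_of_one_le_left (sq_nonneg _) hC3
    linarith

/-- Interpolation between the endpoints: with `S = t^(-d/2)` the supremum bound, `h^r ≤ S^(r-1) h`
reduces the norm of exponent `r` to the mass of `h`, and the power `(r - 1)/r` of `S` equals `1/p`.
-/
theorem gridNorm_le (hdx : 0 < dx) {p q : ℝ≥0∞} (hpq : p⁻¹ + q⁻¹ = 1) {t B : ℝ} (ht : 0 < t)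
    (hB : 0 < B) {f h : Grid d → ℝ} (hf : ∀ α, |f α| ≤ B * h α) (h0 : ∀ α, 0 ≤ h α)
    (hS : ∀ α, h α ≤ (√t)⁻¹ ^ d) (hsum : Summable fun α => h α * dx ^ d)
    (hle : ∑' α, h α * dx ^ d ≤ 5 ^ d) :
    gridNorm dx q f ≤ ENNReal.ofReal (B * 5 ^ d * t ^ (-((d : ℝ) / 2) * (p⁻¹).toReal)) := by
  set S := (√t)⁻¹ ^ d with hSdef
  have hS0 : 0 < S := by have := Real.sqrt_pos.2 ht; positivity
  have hSt : ∀ x : ℝ, t ^ (-((d : ℝ) / 2) * x) = S ^ x := by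
    intro x
    rw [hSdef, ← rpow_neg_half_eq ht, ← Real.rpow_mul ht.le]
    congr 1; ring
  have h5 : (1 : ℝ) ≤ 5 ^ d := one_le_pow₀ (by norm_num)
  have hadd : (p⁻¹).toReal + (q⁻¹).toReal = 1 := by
    have hp : p⁻¹ ≠ ∞ := fun e => by rw [e] at hpq; simp at hpq
    have hq : q⁻¹ ≠ ∞ := fun e => by rw [e] at hpq; simp at hpq
    rw [← ENNReal.toReal_add hp hq, hpq, ENNReal.toReal_one]
  have hfe : ∀ α, ‖f α‖ₑ ≤ ENNReal.ofReal (B * h α) := fun α => by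
    rw [← ofReal_norm]; exact ENNReal.ofReal_le_ofReal (hf α)
  rw [hSt, gridNorm]
  split_ifs with hq
  · rw [hq, ENNReal.inv_top, ENNReal.toReal_zero, add_zero] at hadd
    rw [hadd, Real.rpow_one]
    refine iSup_le fun α => (hfe α).trans (ENNReal.ofReal_le_ofReal ?_)
    calc B * h α ≤ B * 1 * S := by rw [mul_one]; gcongr; exact hS α
      _ ≤ B * 5 ^ d * S := by gcongr
  · set r := q.toReal with hr
    have hr1 : 1 ≤ r := by
      have h1 : (q⁻¹).toReal ≤ 1 := by linarith [ENNReal.toReal_nonneg (a := p⁻¹)]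
      have hq0 : q ≠ 0 := fun e => by rw [e] at hpq; simp at hpq
      have hr0 : 0 < r := ENNReal.toReal_pos hq0 hq
      rw [ENNReal.toReal_inv, ← hr] at h1
      exact (inv_le_one₀ hr0).1 h1
    have hr0 : 0 < r := by linarith
    have hp : (p⁻¹).toReal = 1 - 1 / r := by
      rw [ENNReal.toReal_inv q, ← hr] at hadd
      rw [one_div]; linarith
    have hterm : ∀ α, ‖f α‖ₑ ^ r * ENNReal.ofReal (dx ^ d)
        ≤ ENNReal.ofReal (B ^ r * S ^ (r - 1) * (h α * dx ^ d)) := by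
      intro α
      have h1 : ‖f α‖ₑ ^ r ≤ ENNReal.ofReal ((B * h α) ^ r) := by
        rw [← ENNReal.ofReal_rpow_of_nonneg (mul_nonneg hB.le (h0 α)) hr0.le]
        exact ENNReal.rpow_le_rpow (hfe α) hr0.le
      have h2 : h α ^ r ≤ S ^ (r - 1) * h α := by
        rcases (h0 α).eq_or_lt with e | e
        · rw [← e, Real.zero_rpow hr0.ne', mul_zero]
        · calc h α ^ r = h α ^ (r - 1) * h α := by
                rw [← Real.rpow_add_one e.ne', sub_add_cancel]
            _ ≤ S ^ (r - 1) * h α := by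
                have := Real.rpow_le_rpow (h0 α) (hS α) (sub_nonneg.2 hr1)
                gcongr
      refine (mul_le_mul_left h1 _).trans ?_
      rw [← ENNReal.ofReal_mul (Real.rpow_nonneg (mul_nonneg hB.le (h0 α)) _)]
      refine ENNReal.ofReal_le_ofReal ?_
      rw [Real.mul_rpow hB.le (h0 α)]
      calc B ^ r * h α ^ r * dx ^ d ≤ B ^ r * (S ^ (r - 1) * h α) * dx ^ d := by gcongr
        _ = _ := by ring
    have htsum : ∑' α, ‖f α‖ₑ ^ r * ENNReal.ofReal (dx ^ d)
        ≤ ENNReal.ofReal (B ^ r * S ^ (r - 1) * 5 ^ d) := by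
      refine (ENNReal.tsum_le_tsum hterm).trans ?_
      rw [← ENNReal.ofReal_tsum_of_nonneg (fun α => mul_nonneg (by positivity)
        (mul_nonneg (h0 α) (by positivity))) (hsum.mul_left _), tsum_mul_left]
      refine ENNReal.ofReal_le_ofReal ?_
      gcongr
    refine (ENNReal.rpow_le_rpow htsum (by positivity)).trans ?_
    rw [ENNReal.ofReal_rpow_of_nonneg (by positivity) (by positivity)]
    refine ENNReal.ofReal_le_ofReal ?_
    rw [Real.mul_rpow (by positivity) (by positivity), Real.mul_rpow (by positivity) (by positivity),
      ← Real.rpow_mul hB.le, ← Real.rpow_mul hS0.le, mul_one_div, div_self hr0.ne', Real.rpow_one,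
      hp]
    have e : (r - 1) * (1 / r) = 1 - 1 / r := by field_simp
    rw [e]
    have h6 : ((5 : ℝ) ^ d) ^ (1 / r) ≤ 5 ^ d := by
      refine (Real.rpow_le_rpow_of_exponent_le h5 ?_).trans_eq (Real.rpow_one _)
      rw [div_le_one hr0]; exact hr1
    calc B * S ^ (1 - 1 / r) * ((5 : ℝ) ^ d) ^ (1 / r) ≤ B * S ^ (1 - 1 / r) * 5 ^ d := by gcongr
      _ = _ := by ring

end FinalBounds

end

end SemiDiscreteHeat

/-! ### The main theorem -/

theorem mainTheorem2 (d : ℕ) (hd : 1 ≤ d) (cmin cmax L : ℝ) (hcmin : 0 < cmin) :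
    (∀ (dx : ℝ) (c : Grid d → Fin d → ℝ), 0 < dx → Admissible dx c cmin cmax L →
      WellDefined dx c ∧
      (∀ T : ℝ, 0 < T → ∀ β : Grid d,
        IsFundamentalSolution dx (fun _ => c β) T
          (fun t α γ => frozenKernel dx c t (α - γ) β)) ∧
      (∀ T : ℝ, 0 < T → IsFundamentalSolution dx c T (Gam dx c)) ∧
      (∀ (t s : ℝ), 0 ≤ s → s ≤ t → ∀ α β : Grid d,
        DConvSummable dx (Gam dx c s) (Gam dx c (t - s)) α β ∧
        Gam dx c t α β = dconv dx (Gam dx c s) (Gam dx c (t - s)) α β)) ∧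
    (∀ T : ℝ, 0 < T → ∃ C : ℝ,
      ∀ (dx : ℝ) (c : Grid d → Fin d → ℝ), 0 < dx → Admissible dx c cmin cmax L →
        ∀ t ∈ Set.Ioc (0 : ℝ) T, ∀ α β : Grid d,
          |Gam dx c t α β| ≤ C * lorentzBound dx c t α β) ∧
    (∀ T : ℝ, 0 < T → ∀ p p' : ℝ≥0∞, ENNReal.HolderConjugate p p' → ∃ C : ℝ,
      ∀ (dx : ℝ) (c : Grid d → Fin d → ℝ), 0 < dx → Admissible dx c cmin cmax L →
        ∀ t ∈ Set.Ioc (0 : ℝ) T, ∀ α β : Grid d,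
          gridNorm dx p' (fun γ => Gam dx c t γ β) + gridNorm dx p' (fun γ => Gam dx c t α γ) ≤
            ENNReal.ofReal (C * t ^ (-((d : ℝ) / 2) * (p⁻¹).toReal))) := by
  refine ⟨fun dx c hdx h => ⟨wellDefined hdx h.bounded, fun T _ β => ?_, fun T _ => ?_,
    fun t s _ _ α β => Gam_semigroup hdx h.bounded t s α β⟩, fun T hT => ?_,
    fun T hT p p' hpp => ?_⟩
  · exact isFundamentalSolution_of_eq_entry_exp (h.bounded.imp fun M hM _ j => hM β j) T
      fun t α γ => frozenKernel_eq_entry t α γ β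
  · exact isFundamentalSolution_of_eq_entry_exp h.bounded T
      fun t α β => by rw [Gam_eq_entry hdx h.bounded]
  · obtain ⟨C, hC, hb⟩ := exists_Gam_le_heatBound d (cmax := cmax) L hcmin hT
    refine ⟨C * (1 + √(2 * cmax) + 1 / (2 * cmin)) ^ d, fun dx c hdx h t ht α β => ?_⟩
    rw [mul_assoc]
    exact (hb dx c hdx h t ht.1 ht.2 α β).trans
      (mul_le_mul_of_nonneg_left (heatBound_le_lorentzBound hd hcmin hdx h ht.1 α β) hC.le)
  · obtain ⟨C, hC, hb⟩ := exists_Gam_le_heatBound d (cmax := cmax) L hcmin hT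
    have hpq : p⁻¹ + p'⁻¹ = 1 := by
      have := hpp.inv_add_inv_eq_inv
      rwa [inv_one] at this
    -- One summand for each slice of the kernel; `heatBound` depends on the difference of its
    -- indices only, so both slices have the same mass.
    refine ⟨C * 5 ^ d + C * 5 ^ d, fun dx c hdx h t ht α β => ?_⟩
    have hb' := hb dx c hdx h t ht.1 ht.2
    obtain ⟨hs, hle⟩ := summable_heatBound (d := d) hdx ht.1
    have htp := Real.rpow_pos_of_pos ht.1 (-((d : ℝ) / 2) * (p⁻¹).toReal)
    rw [add_mul, ENNReal.ofReal_add (by positivity) (by positivity)]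
    refine add_le_add ?_ ?_
    · exact gridNorm_le hdx hpq ht.1 hC (h := fun γ => heatBound dx t (γ - β))
        (fun γ => hb' γ β) (fun γ => (heatBound_pos hdx ht.1 _).le)
        (fun γ => heatBound_le hdx ht.1 _)
        (((Equiv.subRight β).summable_iff (f := fun η => heatBound dx t η * dx ^ d)).2 hs)
        (((Equiv.subRight β).tsum_eq fun η => heatBound dx t η * dx ^ d).trans_le hle)
    · exact gridNorm_le hdx hpq ht.1 hC (h := fun γ => heatBound dx t (α - γ))
        (fun γ => hb' α γ) (fun γ => (heatBound_pos hdx ht.1 _).le)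
        (fun γ => heatBound_le hdx ht.1 _)
        (((Equiv.subLeft α).summable_iff (f := fun η => heatBound dx t η * dx ^ d)).2 hs)
        (((Equiv.subLeft α).tsum_eq fun η => heatBound dx t η * dx ^ d).trans_le hle)
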